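/- For $i,j\in\mathbb Z$ let $\langle i,j\rangle=\{k\in\mathbb Z: i\le k\le j\}$. For a finite set $A\subset\mathbb Z$ and an integer $p\ge 2$ put $A_p=\left\{\sum_{i=1}^{\infty}\frac{x_i}{p^i}: x_i\in A\right\}\subset\mathbb R$. For positive integers $l,r,p$ with $p>2$ and $l+r<p$ let $A(l,r,p)=\langle 0,l-1\rangle\cup\langle p-r,p-1\rangle$ and $C(l,r,p)=A(l,r,p)_p$. For $X,Y\subset\mathbb R$ write $X-Y=\{x-y: x\in X,\ y\in Y\}$. A Cantor set is a nonempty, bounded, perfect, nowhere dense subset of $\mathbb R$. A gap of $E\subset\mathbb R$ is a bounded connected component of $\mathbb R\setminus E$; a component of $E$ is proper if it is not a singleton. A point is accumulated by gaps and proper components of $E$ if each of its neighbourhoods contains a gap of $E$ and contains a proper component of $E$. A perfect set $E\subset\mathbb R$ with infinitely many gaps is called - an M-Cantorval if both endpoints of every gap are accumulated by gaps and proper components of $E$; - an L-Cantorval (respectively, an R-Cantorval) if the left (right) endpoint of every gap is accumulated by gaps and proper components of $E$, and the right (left) endpoint of every gap is an endpoint of a proper component of $E$. **Theorem.** Let $l_1,r_1,l_2,r_2,p$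 be positive integers with $p>2$, $l_1+r_1<p$ and $l_2+r_2<p$. Consider the conditions - (S1) $l_1+l_2+r_2\ge p$ or $l_1+r_1+r_2\ge p$; - (S2) $l_1+r_1+l_2\ge p$ or $r_1+l_2+r_2\ge p$; - (S3) $l_1+r_1+l_2+r_2\le p$; - (S1*) $l_1+l_2+r_2>p$ or $l_1+r_1+r_2>p$; - (S2*) $l_1+r_1+l_2>p$ or $r_1+l_2+r_2>p$. Let $D=C(l_1,r_1,p)-C(l_2,r_2,p)$. Then: 1. $D=[-1,1]$ if and only if (S1) and (S2) hold. 2. $D$ is a Cantor set if and only if (S3) holds. 3. $D$ is an L-Cantorval if and only if (S1*) holds and (S2) does not hold. 4. $D$ is an R-Cantorval if and only if (S2*) holds and (S1) does not hold. 5. $D$ is an M-Cantorval if and only if none of (S1*), (S2*), (S3) holds and at least one of (S1), (S2) does not hold. -/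

import Mathlib

open scoped Pointwise

namespace SCantor

/-- `K` is a (connected) component of the set `S` of reals. -/
def IsComponentOf (K S : Set ℝ) : Prop :=
  ∃ x ∈ S, K = connectedComponentIn S x

/-- A gap of `E` is a bounded component of the complement of `E`. -/
def IsGap (E G : Set ℝ) : Prop :=
  IsComponentOf G Eᶜ ∧ Bornology.IsBounded G

/-- A proper component of `E` is a component of `E` that is not a singleton
(a component being nonempty, this means that it has at least two points). -/
def IsProperComponent (E K : Set ℝ) : Prop :=
  IsComponentOf K E ∧ K.Nontrivial

/-- The point `x` is accumulated by gaps and proper components of `E`: every neighbourhood of `x`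
contains a gap of `E` and contains a proper component of `E`. -/
def IsAccumulated (E : Set ℝ) (x : ℝ) : Prop :=
  ∀ ε : ℝ, 0 < ε →
    (∃ G, IsGap E G ∧ G ⊆ Set.Ioo (x - ε) (x + ε)) ∧
    (∃ K, IsProperComponent E K ∧ K ⊆ Set.Ioo (x - ε) (x + ε))

/-- The point `x` is an endpoint (left or right) of some proper component of `E`. -/
def IsEndpointOfProperComponent (E : Set ℝ) (x : ℝ) : Prop :=
  ∃ K, IsProperComponent E K ∧ (IsGLB K x ∨ IsLUB K x)

/-- A Cantor set: a nonempty bounded perfect nowhere dense subset of the line.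
(`Perfect` means closed and without isolated points.) -/
structure IsCantorSet (E : Set ℝ) : Prop where
  nonempty : E.Nonempty
  bounded : Bornology.IsBounded E
  perfect : Perfect E
  nowhereDense : IsNowhereDense E

/-- An L-Cantorval: the left endpoint of any gap is accumulated by gaps and proper components, the
right endpoint of any gap is an endpoint of a proper component. -/
structure IsLCantorval (E : Set ℝ) : Prop where
  perfect : Perfect E
  infinite_gaps : {G | IsGap E G}.Infinite
  left_endpoint : ∀ G, IsGap E G → ∀ x, IsGLB G x → IsAccumulated E x
  right_endpoint : ∀ G, IsGap E G → ∀ x, IsLUB G x → IsEndpointOfProperComponent E x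

/-- An R-Cantorval: the right endpoint of any gap is accumulated by gaps and proper components, the
left endpoint of any gap is an endpoint of a proper component. -/
structure IsRCantorval (E : Set ℝ) : Prop where
  perfect : Perfect E
  infinite_gaps : {G | IsGap E G}.Infinite
  right_endpoint : ∀ G, IsGap E G → ∀ x, IsLUB G x → IsAccumulated E x
  left_endpoint : ∀ G, IsGap E G → ∀ x, IsGLB G x → IsEndpointOfProperComponent E x

/-- An M-Cantorval: both endpoints of any gap are accumulated by gaps and proper components. -/
structure IsMCantorval (E : Set ℝ) : Prop where
  perfect : Perfect E
  infinite_gaps : {G | IsGap E G}.Infinite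
  left_endpoint : ∀ G, IsGap E G → ∀ x, IsGLB G x → IsAccumulated E x
  right_endpoint : ∀ G, IsGap E G → ∀ x, IsLUB G x → IsAccumulated E x

/-- The set `A_p` of the sums `∑_{i ≥ 1} x_i / p ^ i` with all digits `x_i` in `A`; the digit
`x_i` is `d (i - 1)`. -/
def digitSums (A : Finset ℤ) (p : ℕ) : Set ℝ :=
  {x | ∃ d : ℕ → ℤ, (∀ i, d i ∈ A) ∧ HasSum (fun i : ℕ => (d i : ℝ) / (p : ℝ) ^ (i + 1)) x}

/-- The digit set `A(l, r, p) = ⟨0, l - 1⟩ ∪ ⟨p - r, p - 1⟩`, a union of two intervals of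
integers. -/
noncomputable def digits (l r p : ℕ) : Finset ℤ :=
  Finset.Icc (0 : ℤ) ((l : ℤ) - 1) ∪ Finset.Icc ((p : ℤ) - (r : ℤ)) ((p : ℤ) - 1)

/-- The S-Cantor set `C(l, r, p) = A(l, r, p)_p`. -/
def C (l r p : ℕ) : Set ℝ := digitSums (digits l r p) p

/-- Condition (S1). -/
def S1 (l₁ r₁ l₂ r₂ p : ℕ) : Prop := l₁ + l₂ + r₂ ≥ p ∨ l₁ + r₁ + r₂ ≥ p

/-- Condition (S2). -/
def S2 (l₁ r₁ l₂ r₂ p : ℕ) : Prop := l₁ + r₁ + l₂ ≥ p ∨ r₁ + l₂ + r₂ ≥ p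

/-- Condition (S3). -/
def S3 (l₁ r₁ l₂ r₂ p : ℕ) : Prop := l₁ + r₁ + l₂ + r₂ ≤ p

/-- Condition (S1*). -/
def S1Star (l₁ r₁ l₂ r₂ p : ℕ) : Prop := l₁ + l₂ + r₂ > p ∨ l₁ + r₁ + r₂ > p

/-- Condition (S2*). -/
def S2Star (l₁ r₁ l₂ r₂ p : ℕ) : Prop := l₁ + r₁ + l₂ > p ∨ r₁ + l₂ + r₂ > p

end SCantor

namespace SCantor

/-! Subtracting digit by digit, `D` consists of the sums with digits in three integer blocks: `-p+1`
to `a-p-1`, `-m+1` to `M-1`, and `p-b+1` to `p-1`, where `a = l₁+r₂`, `b = r₁+l₂`, `m = max l₂ r₁`,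
`M = max l₁ r₂`. (S1) says that at most one integer is missing between the first two blocks, (S1*)
that none is; (S2) and (S2*) say the same of the last two. (S3) says that the digits miss a residue
mod `p`. Reflection swaps `a` with `b` and `m` with `M`.

The cell `(k/p, (k+1)/p)` carries a copy of `D ∩ (0,1)` if `k` is a digit, together with a copy of
`D ∩ (-1,0)` if `k+1` is one (`mem_cell_iff`). If (S3) fails, `D` and its integer translates cover
the line, so two adjacent digits fill a cell. A gap inside a cell then sits in a single copy and can
be magnified by `p`, until its left endpoint is some `k/p` to the right of which no digit is
available; there `D` looks on the left as it does near 1 (`isLeftType_of_isGapIoo`). Near 1 `D` is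
self-similar, so one missing point and one interval in `(0,1)` make every left endpoint accumulated.

Under (S1*), `[-1,0] ⊆ D`, and the mirrored statement puts an interval to the right of each gap.
Under (S3), an interval in `D` would force `(0,1) ⊆ D`, which a cell without digits refutes. Under
(S1) and (S2), `[-1,1]` can be expanded digit by digit. The five hypotheses are exhaustive and the
five types exclude one another, so these implications give the equivalences. -/

/-! ### Gaps, components and accumulation on the line -/

/-- `(u, v)` is a bounded complementary interval of `E` with endpoints in `E`. -/
structure IsGapIoo (E : Set ℝ) (u v : ℝ) : Prop where
  lt : u < v
  left_mem : u ∈ E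
  right_mem : v ∈ E
  notMem : ∀ x, u < x → x < v → x ∉ E

theorem IsGapIoo.neg {E : Set ℝ} {u v : ℝ} (h : IsGapIoo E u v) : IsGapIoo (-E) (-v) (-u) where
  lt := neg_lt_neg h.lt
  left_mem := by simpa using h.right_mem
  right_mem := by simpa using h.left_mem
  notMem x h1 h2 hx := h.notMem (-x) (by linarith) (by linarith) hx

theorem IsGapIoo.connectedComponentIn_eq {E : Set ℝ} {u v x : ℝ} (h : IsGapIoo E u v)
    (hux : u < x) (hxv : x < v) : connectedComponentIn Eᶜ x = Set.Ioo u v := by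
  have hx : x ∈ Eᶜ := h.notMem x hux hxv
  have hoc : (connectedComponentIn Eᶜ x).OrdConnected :=
    isPreconnected_connectedComponentIn.ordConnected
  have hxm : x ∈ connectedComponentIn Eᶜ x := mem_connectedComponentIn hx
  have hsub := connectedComponentIn_subset Eᶜ x
  apply Set.Subset.antisymm
  · intro y hy
    constructor
    · by_contra hc
      exact hsub (hoc.out hy hxm ⟨not_lt.1 hc, hux.le⟩) h.left_mem
    · by_contra hc
      exact hsub (hoc.out hxm hy ⟨hxv.le, not_lt.1 hc⟩) h.right_mem
  · exact isPreconnected_Ioo.subset_connectedComponentIn ⟨hux, hxv⟩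
      (fun y hy => h.notMem y hy.1 hy.2)

theorem IsGapIoo.isGap {E : Set ℝ} {u v : ℝ} (h : IsGapIoo E u v) : IsGap E (Set.Ioo u v) := by
  obtain ⟨x, h1, h2⟩ := exists_between h.lt
  exact ⟨⟨x, h.notMem x h1 h2, (h.connectedComponentIn_eq h1 h2).symm⟩, Metric.isBounded_Ioo u v⟩

/-- The endpoints are the last point of `E` before `c` and the first one after it, attained because
`E` is closed. -/
theorem exists_isGapIoo {E : Set ℝ} (hE : IsClosed E) {s c t : ℝ} (hs : s ∈ E) (ht : t ∈ E)
    (hc : c ∉ E) (hsc : s < c) (hct : c < t) :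
    ∃ u v, IsGapIoo E u v ∧ s ≤ u ∧ u < c ∧ c < v ∧ v ≤ t := by
  have hb1 : BddAbove (E ∩ Set.Iic c) := ⟨c, fun y hy => hy.2⟩
  have hb2 : BddBelow (E ∩ Set.Ici c) := ⟨c, fun y hy => hy.2⟩
  have h1 : sSup (E ∩ Set.Iic c) ∈ E ∩ Set.Iic c :=
    (hE.inter isClosed_Iic).csSup_mem ⟨s, hs, hsc.le⟩ hb1
  have h2 : sInf (E ∩ Set.Ici c) ∈ E ∩ Set.Ici c :=
    (hE.inter isClosed_Ici).csInf_mem ⟨t, ht, hct.le⟩ hb2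
  have h3 : sSup (E ∩ Set.Iic c) < c := lt_of_le_of_ne h1.2 fun h => hc (h ▸ h1.1)
  have h4 : c < sInf (E ∩ Set.Ici c) := lt_of_le_of_ne h2.2 fun h => hc (h ▸ h2.1)
  refine ⟨_, _, ⟨h3.trans h4, h1.1, h2.1, fun x hx1 hx2 hx => ?_⟩,
    le_csSup hb1 ⟨hs, hsc.le⟩, h3, h4, csInf_le hb2 ⟨ht, hct.le⟩⟩
  rcases le_total x c with h | h
  · exact absurd (le_csSup hb1 ⟨hx, h⟩) (not_le.2 hx1)
  · exact absurd (csInf_le hb2 ⟨hx, h⟩) (not_le.2 hx2)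

theorem IsGap.exists_eq_Ioo {E G : Set ℝ} (hE : IsClosed E) (h : IsGap E G) :
    ∃ u v, IsGapIoo E u v ∧ G = Set.Ioo u v := by
  obtain ⟨⟨x, hx, rfl⟩, hb⟩ := h
  have hs : ∃ s ∈ E, s < x := by
    by_contra! hc
    have : Set.Iic x ⊆ connectedComponentIn Eᶜ x :=
      isPreconnected_Iic.subset_connectedComponentIn Set.self_mem_Iic fun y hy hyE =>
        hx (le_antisymm hy (hc y hyE) ▸ hyE)
    exact not_bddBelow_Iic x (hb.subset this).bddBelow
  have ht : ∃ t ∈ E, x < t := by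
    by_contra! hc
    have : Set.Ici x ⊆ connectedComponentIn Eᶜ x :=
      isPreconnected_Ici.subset_connectedComponentIn Set.self_mem_Ici fun y hy hyE =>
        hx (le_antisymm (hc y hyE) hy ▸ hyE)
    exact not_bddAbove_Ici x (hb.subset this).bddAbove
  obtain ⟨s, hs, hsx⟩ := hs
  obtain ⟨t, ht, hxt⟩ := ht
  obtain ⟨u, v, h, -, h1, h2, -⟩ := exists_isGapIoo hE hs ht hx hsx hxt
  exact ⟨u, v, h, h.connectedComponentIn_eq h1 h2⟩

theorem isProperComponent_of_Icc_subset {E : Set ℝ} {a b : ℝ} (hab : a < b)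
    (h : Set.Icc a b ⊆ E) : IsProperComponent E (connectedComponentIn E a) := by
  have ha : a ∈ Set.Icc a b := ⟨le_rfl, hab.le⟩
  have hs := isPreconnected_Icc.subset_connectedComponentIn ha h
  exact ⟨⟨a, h ha, rfl⟩, a, hs ha, b, hs ⟨hab.le, le_rfl⟩, hab.ne⟩

theorem connectedComponentIn_subset_Ioo {E : Set ℝ} {a c d : ℝ} (ha : a ∈ E)
    (hc : c ∉ E) (hd : d ∉ E) (hca : c < a) (had : a < d) :
    connectedComponentIn E a ⊆ Set.Ioo c d := by
  have hoc : (connectedComponentIn E a).OrdConnected :=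
    isPreconnected_connectedComponentIn.ordConnected
  have ham : a ∈ connectedComponentIn E a := mem_connectedComponentIn ha
  have hsub := connectedComponentIn_subset E a
  intro y hy
  constructor
  · by_contra h
    exact hc (hsub (hoc.out hy ham ⟨not_lt.1 h, hca.le⟩))
  · by_contra h
    exact hd (hsub (hoc.out ham hy ⟨had.le, not_lt.1 h⟩))

/-- A point is accumulated by gaps and proper components as soon as there are, arbitrarily close
to it on its left, two points outside of `E` that are separated by an interval inside `E`. -/
theorem isAccumulated_of_left {E : Set ℝ} (hE : IsClosed E) {x : ℝ} (hx : x ∈ E)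
    (h : ∀ ε > 0, ∃ c a b d, x - ε < c ∧ c < a ∧ a < b ∧ b < d ∧ d < x ∧ c ∉ E ∧ d ∉ E ∧
      Set.Icc a b ⊆ E) : IsAccumulated E x := by
  intro ε hε
  obtain ⟨c, a, b, d, h1, h2, h3, h4, h5, hc, hd, hab⟩ := h ε hε
  have ha : a ∈ E := hab ⟨le_rfl, h3.le⟩
  have hb : b ∈ E := hab ⟨h3.le, le_rfl⟩
  constructor
  · obtain ⟨u, v, hg, hu, -, -, hv⟩ := exists_isGapIoo hE hb hx hd h4 h5
    exact ⟨_, hg.isGap, Set.Ioo_subset_Ioo (by linarith) (by linarith)⟩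
  · exact ⟨_, isProperComponent_of_Icc_subset h3 hab,
      (connectedComponentIn_subset_Ioo ha hc hd h2 (h3.trans h4)).trans
        (Set.Ioo_subset_Ioo (by linarith) (by linarith))⟩

/-! ### Reflection -/

theorem neg_connectedComponentIn {E : Set ℝ} {x : ℝ} (hx : x ∈ E) :
    -connectedComponentIn E x = connectedComponentIn (-E) (-x) := by
  have := (Homeomorph.neg ℝ).image_connectedComponentIn hx
  simpa using this

theorem IsComponentOf.neg {K S : Set ℝ} (h : IsComponentOf K S) : IsComponentOf (-K) (-S) := by
  obtain ⟨x, hx, rfl⟩ := h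
  exact ⟨-x, by simpa using hx, neg_connectedComponentIn hx⟩

theorem IsGap.neg {E G : Set ℝ} (h : IsGap E G) : IsGap (-E) (-G) := by
  have hc : (-E)ᶜ = -Eᶜ := rfl
  exact ⟨hc ▸ h.1.neg, h.2.neg⟩

theorem IsProperComponent.neg {E K : Set ℝ} (h : IsProperComponent E K) :
    IsProperComponent (-E) (-K) := by
  obtain ⟨hK, a, ha, b, hb, hab⟩ := h
  exact ⟨hK.neg, -a, by simpa using ha, -b, by simpa using hb, fun h => hab (neg_injective h)⟩

theorem IsAccumulated.neg {E : Set ℝ} {x : ℝ} (h : IsAccumulated E x) :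
    IsAccumulated (-E) (-x) := by
  have key : ∀ {S : Set ℝ} {ε : ℝ}, S ⊆ Set.Ioo (x - ε) (x + ε) →
      -S ⊆ Set.Ioo (-x - ε) (-x + ε) := by
    intro S ε hS y hy
    have := hS hy
    exact ⟨by linarith [this.2], by linarith [this.1]⟩
  intro ε hε
  obtain ⟨⟨G, hG, hGs⟩, ⟨K, hK, hKs⟩⟩ := h ε hε
  exact ⟨⟨-G, hG.neg, key hGs⟩, ⟨-K, hK.neg, key hKs⟩⟩

theorem IsEndpointOfProperComponent.neg {E : Set ℝ} {x : ℝ}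
    (h : IsEndpointOfProperComponent E x) : IsEndpointOfProperComponent (-E) (-x) := by
  obtain ⟨K, hK, h | h⟩ := h
  · exact ⟨-K, hK.neg, Or.inr h.neg⟩
  · exact ⟨-K, hK.neg, Or.inl h.neg⟩

theorem isPerfect_neg {E : Set ℝ} (h : Perfect E) : Perfect (-E) := by
  refine ⟨h.closed.neg, fun x hx => ?_⟩
  have := h.acc (-x) hx
  rw [accPt_iff_nhds] at this ⊢
  intro U hU
  have hU' : -U ∈ nhds (-x) := by
    simpa using (Homeomorph.neg ℝ).isOpenMap.image_mem_nhds hU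
  obtain ⟨y, hy, hne⟩ := this _ hU'
  exact ⟨-y, ⟨hy.1, by simpa using hy.2⟩, fun h => hne (by rw [← h, neg_neg])⟩

theorem infinite_isGap_neg {E : Set ℝ} (h : {G | IsGap E G}.Infinite) :
    {G | IsGap (-E) G}.Infinite :=
  (h.image (neg_injective.injOn (s := {G | IsGap E G}))).mono (by
    rintro _ ⟨G, hG, rfl⟩; exact IsGap.neg hG)

theorem IsGap.of_neg {E G : Set ℝ} (h : IsGap (-E) G) : IsGap E (-G) := by simpa using h.neg

theorem IsLCantorval.neg {E : Set ℝ} (h : IsLCantorval E) : IsRCantorval (-E) where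
  perfect := isPerfect_neg h.perfect
  infinite_gaps := infinite_isGap_neg h.infinite_gaps
  right_endpoint G hG x hx := by
    simpa using (h.left_endpoint _ hG.of_neg (-x) hx.neg).neg
  left_endpoint G hG x hx := by
    simpa using (h.right_endpoint _ hG.of_neg (-x) hx.neg).neg

theorem IsRCantorval.neg {E : Set ℝ} (h : IsRCantorval E) : IsLCantorval (-E) where
  perfect := isPerfect_neg h.perfect
  infinite_gaps := infinite_isGap_neg h.infinite_gaps
  right_endpoint G hG x hx := by
    simpa using (h.left_endpoint _ hG.of_neg (-x) hx.neg).neg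
  left_endpoint G hG x hx := by
    simpa using (h.right_endpoint _ hG.of_neg (-x) hx.neg).neg

theorem IsMCantorval.neg {E : Set ℝ} (h : IsMCantorval E) : IsMCantorval (-E) where
  perfect := isPerfect_neg h.perfect
  infinite_gaps := infinite_isGap_neg h.infinite_gaps
  right_endpoint G hG x hx := by
    simpa using (h.left_endpoint _ hG.of_neg (-x) hx.neg).neg
  left_endpoint G hG x hx := by
    simpa using (h.right_endpoint _ hG.of_neg (-x) hx.neg).neg

/-! ### Mutual exclusion of the types, infinitude of gaps -/

theorem isEndpointOfProperComponent_of_Icc_subset {E : Set ℝ} {u v w : ℝ} (h : IsGapIoo E u v)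
    (hvw : v < w) (hs : Set.Icc v w ⊆ E) : IsEndpointOfProperComponent E v := by
  refine ⟨_, isProperComponent_of_Icc_subset hvw hs, Or.inl (IsLeast.isGLB ?_)⟩
  refine ⟨mem_connectedComponentIn h.right_mem, fun y hy => ?_⟩
  by_contra! hc
  obtain ⟨z, hz1, hz2⟩ := exists_between (max_lt h.lt hc)
  obtain ⟨hz1, hz3⟩ := max_lt_iff.1 hz1
  have hoc : (connectedComponentIn E v).OrdConnected :=
    isPreconnected_connectedComponentIn.ordConnected
  exact h.notMem z hz1 hz2 (connectedComponentIn_subset E v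
    (hoc.out hy (mem_connectedComponentIn h.right_mem) ⟨hz3.le, hz2.le⟩))

theorem IsProperComponent.ordConnected {E K : Set ℝ} (h : IsProperComponent E K) :
    K.OrdConnected := by
  obtain ⟨⟨x, hx, rfl⟩, -⟩ := h
  exact isPreconnected_connectedComponentIn.ordConnected

theorem IsProperComponent.subset {E K : Set ℝ} (h : IsProperComponent E K) : K ⊆ E := by
  obtain ⟨⟨x, hx, rfl⟩, -⟩ := h
  exact connectedComponentIn_subset E x

theorem IsProperComponent.exists_lt {E K : Set ℝ} (h : IsProperComponent E K) :
    ∃ a ∈ K, ∃ b ∈ K, a < b := by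
  obtain ⟨a, ha, b, hb, hab⟩ := h.2
  rcases lt_or_gt_of_ne hab with h | h
  · exact ⟨a, ha, b, hb, h⟩
  · exact ⟨b, hb, a, ha, h⟩

/-- A proper component ending at `v` lies to its right, as `(u, v)` misses `E`. With a gap on one
side and an interval on the other, no gap fits into a small neighbourhood of `v`. This separates
L-Cantorvals from the R and M types. -/
theorem IsGapIoo.not_isAccumulated_right {E : Set ℝ} (hE : IsClosed E) {u v : ℝ}
    (h : IsGapIoo E u v) (hv : IsEndpointOfProperComponent E v) : ¬ IsAccumulated E v := by
  intro hacc
  obtain ⟨K, hK, hv | hv⟩ := hv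
  · obtain ⟨a, ha, z, hz, haz⟩ := hK.exists_lt
    have hvz : v < z := (hv.1 ha).trans_lt haz
    have hfull : ∀ q, v < q → q ≤ z → q ∈ E := by
      intro q hq hqz
      obtain ⟨k, hk, -, hkq⟩ := hv.exists_between hq
      exact hK.subset (hK.ordConnected.out hk hz ⟨hkq.le, hqz⟩)
    have hε : 0 < min ((v - u) / 2) (z - v) := lt_min (by linarith [h.lt]) (by linarith)
    obtain ⟨G, hG, hGs⟩ := (hacc _ hε).1
    obtain ⟨u', v', hg, rfl⟩ := hG.exists_eq_Ioo hE
    have hm1 := min_le_left ((v - u) / 2) (z - v)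
    have hm2 := min_le_right ((v - u) / 2) (z - v)
    obtain ⟨h1, h2⟩ := (Set.Ioo_subset_Ioo_iff hg.lt).1 hGs
    have huv := h.lt
    rcases le_or_gt v' v with h3 | h3
    · exact h.notMem u' (by linarith) (by linarith [hg.lt]) hg.left_mem
    · obtain ⟨q, hq1, hq2⟩ := exists_between (max_lt hg.lt h3)
      obtain ⟨hq1, hq3⟩ := max_lt_iff.1 hq1
      exact hg.notMem q hq1 hq2 (hfull q hq3 (by linarith))
  · obtain ⟨y, hy, z, hz, hyz⟩ := hK.exists_lt
    have hyv : y < v := hyz.trans_le (hv.1 hz)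
    obtain ⟨k, hk, hk1, hk2⟩ := hv.exists_between (max_lt h.lt hyv)
    obtain ⟨hk1, hk3⟩ := max_lt_iff.1 hk1
    obtain ⟨q, hq1, hq2⟩ := exists_between (max_lt hk1 hk3)
    obtain ⟨hq1, hq3⟩ := max_lt_iff.1 hq1
    exact h.notMem q hq1 (hq2.trans_le hk2)
      (hK.subset (hK.ordConnected.out hy hk ⟨hq3.le, hq2.le⟩))

theorem exists_isGapIoo_of_infinite {E : Set ℝ} (hE : IsClosed E)
    (h : {G | IsGap E G}.Infinite) : ∃ u v, IsGapIoo E u v := by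
  obtain ⟨G, hG⟩ := h.nonempty
  obtain ⟨u, v, hg, -⟩ := IsGap.exists_eq_Ioo hE hG
  exact ⟨u, v, hg⟩

theorem IsAccumulated.not_isNowhereDense {E : Set ℝ} {x : ℝ} (h : IsAccumulated E x) :
    ¬ IsNowhereDense E := by
  intro hn
  obtain ⟨K, hK, -⟩ := (h 1 one_pos).2
  obtain ⟨a, ha, b, hb, hab⟩ := hK.exists_lt
  have hs : Set.Ioo a b ⊆ interior (closure E) :=
    interior_maximal (fun y hy => subset_closure
      (hK.subset (hK.ordConnected.out ha hb ⟨hy.1.le, hy.2.le⟩))) isOpen_Ioo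
  obtain ⟨y, hy⟩ := exists_between hab
  rw [hn] at hs
  exact hs hy

theorem IsGapIoo.isGLB {E : Set ℝ} {u v : ℝ} (h : IsGapIoo E u v) : IsGLB (Set.Ioo u v) u :=
  isGLB_Ioo h.lt

theorem IsGapIoo.isLUB {E : Set ℝ} {u v : ℝ} (h : IsGapIoo E u v) : IsLUB (Set.Ioo u v) v :=
  isLUB_Ioo h.lt

theorem IsCantorSet.not_isLCantorval {E : Set ℝ} (h : IsCantorSet E) : ¬ IsLCantorval E := by
  intro h'
  obtain ⟨u, v, hg⟩ := exists_isGapIoo_of_infinite h.perfect.closed h'.infinite_gaps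
  exact (h'.left_endpoint _ hg.isGap _ hg.isGLB).not_isNowhereDense h.nowhereDense

theorem IsCantorSet.not_isRCantorval {E : Set ℝ} (h : IsCantorSet E) : ¬ IsRCantorval E := by
  intro h'
  obtain ⟨u, v, hg⟩ := exists_isGapIoo_of_infinite h.perfect.closed h'.infinite_gaps
  exact (h'.right_endpoint _ hg.isGap _ hg.isLUB).not_isNowhereDense h.nowhereDense

theorem IsCantorSet.not_isMCantorval {E : Set ℝ} (h : IsCantorSet E) : ¬ IsMCantorval E := by
  intro h'
  obtain ⟨u, v, hg⟩ := exists_isGapIoo_of_infinite h.perfect.closed h'.infinite_gaps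
  exact (h'.left_endpoint _ hg.isGap _ hg.isGLB).not_isNowhereDense h.nowhereDense

theorem IsLCantorval.not_isRCantorval {E : Set ℝ} (h : IsLCantorval E) : ¬ IsRCantorval E := by
  intro h'
  obtain ⟨u, v, hg⟩ := exists_isGapIoo_of_infinite h.perfect.closed h'.infinite_gaps
  exact hg.not_isAccumulated_right h.perfect.closed (h.right_endpoint _ hg.isGap _ hg.isLUB)
    (h'.right_endpoint _ hg.isGap _ hg.isLUB)

theorem IsLCantorval.not_isMCantorval {E : Set ℝ} (h : IsLCantorval E) : ¬ IsMCantorval E := by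
  intro h'
  obtain ⟨u, v, hg⟩ := exists_isGapIoo_of_infinite h.perfect.closed h'.infinite_gaps
  exact hg.not_isAccumulated_right h.perfect.closed (h.right_endpoint _ hg.isGap _ hg.isLUB)
    (h'.right_endpoint _ hg.isGap _ hg.isLUB)

theorem IsRCantorval.not_isMCantorval {E : Set ℝ} (h : IsRCantorval E) : ¬ IsMCantorval E :=
  fun h' => h.neg.not_isMCantorval h'.neg

theorem finite_isGap_Icc (a b : ℝ) : ¬ {G | IsGap (Set.Icc a b) G}.Infinite := by
  intro h
  obtain ⟨u, v, hg⟩ := exists_isGapIoo_of_infinite isClosed_Icc h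
  obtain ⟨x, h1, h2⟩ := exists_between hg.lt
  exact hg.notMem x h1 h2 ⟨hg.left_mem.1.trans h1.le, h2.le.trans hg.right_mem.2⟩

/-- Among finitely many gaps one is shortest, but a gap close enough to its left endpoint is at most
half as long. -/
theorem infinite_isGap_of_isAccumulated {E : Set ℝ} (hE : IsClosed E) {u v : ℝ}
    (hg : IsGapIoo E u v) (h : ∀ u v, IsGapIoo E u v → IsAccumulated E u) :
    {G | IsGap E G}.Infinite := by
  intro hfin
  obtain ⟨G, hG, hmin⟩ := Set.exists_min_image _ (fun G : Set ℝ => sSup G - sInf G) hfin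
    ⟨_, hg.isGap⟩
  obtain ⟨u, v, hg, rfl⟩ := IsGap.exists_eq_Ioo hE hG
  have hlt := hg.lt
  obtain ⟨G', hG', hs⟩ := (h u v hg ((v - u) / 4) (by linarith)).1
  obtain ⟨u', v', hg', rfl⟩ := IsGap.exists_eq_Ioo hE hG'
  obtain ⟨h1, h2⟩ := (Set.Ioo_subset_Ioo_iff hg'.lt).1 hs
  have := hmin _ hG'
  simp only [csSup_Ioo hg.lt, csInf_Ioo hg.lt, csSup_Ioo hg'.lt, csInf_Ioo hg'.lt] at this
  linarith

/-! ### Digit sums in base `p` -/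

theorem hasSum_of_eq {f g : ℕ → ℝ} {a b : ℝ} (h : HasSum f a) (hfg : ∀ i, f i = g i)
    (hab : a = b) : HasSum g b :=
  hab ▸ funext hfg ▸ h

theorem summable_digits {p : ℕ} (hp : 2 ≤ p) {d : ℕ → ℤ} {c : ℝ} (hd : ∀ i, |(d i : ℝ)| ≤ c) :
    Summable fun i : ℕ => (d i : ℝ) / (p : ℝ) ^ (i + 1) := by
  have hp' : (2 : ℝ) ≤ p := by exact_mod_cast hp
  have hg : Summable fun i : ℕ => c * (1 / (p : ℝ)) ^ i :=
    (summable_geometric_of_lt_one (by positivity)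
      (by rw [div_lt_one (by linarith)]; linarith)).mul_left c
  refine Summable.of_norm_bounded hg fun i => ?_
  have hpi : (0 : ℝ) < (p : ℝ) ^ i := by positivity
  rw [Real.norm_eq_abs, abs_div, abs_of_pos (by positivity : (0 : ℝ) < (p : ℝ) ^ (i + 1)),
    one_div, inv_pow, ← div_eq_mul_inv]
  have hc : 0 ≤ c := (abs_nonneg _).trans (hd i)
  have : (p : ℝ) ^ i ≤ (p : ℝ) ^ (i + 1) := pow_le_pow_right₀ (by linarith) (Nat.le_succ i)
  gcongr
  exact hd i

theorem exists_abs_le_of_mem (A : Finset ℤ) : ∃ c : ℝ, ∀ a ∈ A, |(a : ℝ)| ≤ c := by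
  obtain ⟨c, hc⟩ := (A.image fun a : ℤ => |(a : ℝ)|).bddAbove
  exact ⟨c, fun a ha => hc (by simpa using ⟨a, ha, rfl⟩)⟩

theorem digitSums_sub {p : ℕ} (hp : 2 ≤ p) (A A' : Finset ℤ) :
    digitSums A p - digitSums A' p = digitSums (A - A') p := by
  ext x
  constructor
  · rintro ⟨y, ⟨d, hd, hy⟩, z, ⟨e, he, hz⟩, rfl⟩
    refine ⟨fun i => d i - e i, fun i => Finset.sub_mem_sub (hd i) (he i), ?_⟩
    exact hasSum_of_eq (hy.sub hz) (fun i => by push_cast; ring) rfl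
  · rintro ⟨f, hf, hx⟩
    choose d hd e he hde using fun i => Finset.mem_sub.1 (hf i)
    obtain ⟨c, hc⟩ := exists_abs_le_of_mem A
    obtain ⟨c', hc'⟩ := exists_abs_le_of_mem A'
    have h1 := (summable_digits hp fun i => hc _ (hd i)).hasSum
    have h2 := (summable_digits hp fun i => hc' _ (he i)).hasSum
    refine ⟨_, ⟨d, hd, h1⟩, _, ⟨e, he, h2⟩, (h1.sub h2).unique ?_⟩
    exact hasSum_of_eq hx (fun i => by rw [← hde i]; push_cast; ring) rfl

theorem mem_digitSums_iff {p : ℕ} (hp : 2 ≤ p) (B : Finset ℤ) (x : ℝ) :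
    x ∈ digitSums B p ↔ ∃ d ∈ B, (p : ℝ) * x - d ∈ digitSums B p := by
  have hp0 : (p : ℝ) ≠ 0 := by positivity
  constructor
  · rintro ⟨d, hd, hx⟩
    refine ⟨d 0, hd 0, fun i => d (i + 1), fun i => hd _, ?_⟩
    have h1 := (hasSum_nat_add_iff' 1).2 (hx.mul_left (p : ℝ))
    refine hasSum_of_eq h1 (fun i => ?_) ?_
    · rw [pow_succ (p : ℝ) (i + 1)]
      field_simp
    · rw [Finset.sum_range_one, zero_add, pow_one]
      field_simp
  · rintro ⟨d, hd, e, he, hx⟩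
    refine ⟨fun i => Nat.casesOn i d e, fun i => by cases i <;> simp [hd, he], ?_⟩
    rw [← hasSum_nat_add_iff' 1]
    refine hasSum_of_eq (hx.div_const (p : ℝ)) (fun i => ?_) ?_
    · rw [pow_succ (p : ℝ) (i + 1), div_div]
    · rw [Finset.sum_range_one, zero_add, pow_one]
      exact (by field_simp : ((p : ℝ) * x - d) / p = x - d / p)

theorem abs_le_one_of_mem_digitSums {p : ℕ} (hp : 2 ≤ p) {B : Finset ℤ}
    (hB : ∀ d ∈ B, |d| ≤ (p : ℤ) - 1) {x : ℝ} (hx : x ∈ digitSums B p) : |x| ≤ 1 := by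
  have hp' : (2 : ℝ) ≤ p := by exact_mod_cast hp
  obtain ⟨d, hd, hx⟩ := hx
  have hg : HasSum (fun i : ℕ => ((p : ℝ) - 1) / (p : ℝ) ^ (i + 1)) 1 := by
    have h := (hasSum_geometric_of_lt_one (r := 1 / (p : ℝ)) (by positivity)
      (by rw [div_lt_one (by linarith)]; linarith)).mul_left (((p : ℝ) - 1) / p)
    refine hasSum_of_eq h (fun i => ?_) ?_
    · rw [pow_succ, one_div, inv_pow]
      field_simp
    · have : (p : ℝ) - 1 ≠ 0 := by linarith
      field_simp
  have hle : ∀ i, |(d i : ℝ) / (p : ℝ) ^ (i + 1)| ≤ ((p : ℝ) - 1) / (p : ℝ) ^ (i + 1) := by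
    intro i
    rw [abs_div, abs_of_pos (by positivity : (0 : ℝ) < (p : ℝ) ^ (i + 1))]
    gcongr
    exact_mod_cast hB _ (hd i)
  rw [abs_le]
  constructor
  · exact hasSum_le (fun i => (abs_le.1 (hle i)).1) hg.neg hx
  · exact hasSum_le (fun i => (abs_le.1 (hle i)).2) hx hg

/-- A bounded set is contained in `B_p` if each of its points can be expanded by one digit without
leaving the set. -/
theorem subset_digitSums {p : ℕ} (hp : 2 ≤ p) {B : Finset ℤ} {S : Set ℝ}
    (hS : ∀ x ∈ S, |x| ≤ 1) (h : ∀ x ∈ S, ∃ d ∈ B, (p : ℝ) * x - d ∈ S) :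
    S ⊆ digitSums B p := by
  have hp' : (2 : ℝ) ≤ p := by exact_mod_cast hp
  choose! f hf hfS using h
  intro x hx
  -- `o n` is the remainder after `n` digits; it stays in `S`, hence bounded, so the error `o n / p
  -- ^ n` of the partial sum tends to 0.
  set o : ℕ → ℝ := fun n => (fun y => (p : ℝ) * y - f y)^[n] x with ho
  have hoS : ∀ n, o n ∈ S := by
    intro n
    induction n with
    | zero => exact hx
    | succ n ih =>
      simp only [ho, Function.iterate_succ_apply'] at ih ⊢
      exact hfS _ ih
  have hos : ∀ n, o (n + 1) = (p : ℝ) * o n - f (o n) := fun n => by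
    simp only [ho, Function.iterate_succ_apply']
  refine ⟨fun n => f (o n), fun n => hf _ (hoS n), ?_⟩
  obtain ⟨c, hc⟩ := exists_abs_le_of_mem B
  have hsum := summable_digits hp fun i => hc _ (hf _ (hoS i))
  rw [hsum.hasSum_iff_tendsto_nat]
  have hpart : ∀ n, ∑ i ∈ Finset.range n, (f (o i) : ℝ) / (p : ℝ) ^ (i + 1) =
      x - o n * (1 / (p : ℝ)) ^ n := by
    intro n
    induction n with
    | zero => simp [ho]
    | succ n ih =>
      rw [Finset.sum_range_succ, ih, hos n]
      have : (p : ℝ) ≠ 0 := by linarith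
      rw [one_div, inv_pow, inv_pow, pow_succ]
      field_simp
      ring
  simp only [hpart]
  have h0 : Filter.Tendsto (fun n => o n * (1 / (p : ℝ)) ^ n) Filter.atTop (nhds 0) := by
    refine squeeze_zero_norm (a := fun n => (1 / (p : ℝ)) ^ n) (fun n => ?_)
      (tendsto_pow_atTop_nhds_zero_of_lt_one (by positivity)
        (by rw [div_lt_one (by linarith)]; linarith))
    rw [norm_mul, Real.norm_eq_abs, norm_pow, Real.norm_eq_abs,
      abs_of_nonneg (by positivity : (0 : ℝ) ≤ 1 / p)]
    exact mul_le_of_le_one_left (by positivity) (hS _ (hoS n))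
  simpa using h0.const_sub x

/-- As `B` is finite, points of the closure can also be expanded by one digit within the closure;
the maximality in `subset_digitSums` does the rest. -/
theorem isClosed_digitSums {p : ℕ} (hp : 2 ≤ p) {B : Finset ℤ}
    (hB : ∀ d ∈ B, |d| ≤ (p : ℤ) - 1) : IsClosed (digitSums B p) := by
  have hsub : closure (digitSums B p) ⊆ {x | |x| ≤ 1} :=
    closure_minimal (fun x hx => abs_le_one_of_mem_digitSums hp hB hx)
      (isClosed_le continuous_abs continuous_const)
  refine isClosed_of_closure_subset (subset_digitSums hp hsub fun x hx => ?_)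
  have hU : digitSums B p =
      ⋃ d ∈ (B : Set ℤ), (fun x : ℝ => (p : ℝ) * x - d) ⁻¹' digitSums B p := by
    ext x
    rw [mem_digitSums_iff hp]
    simp
  rw [hU, B.finite_toSet.closure_biUnion] at hx
  simp only [Set.mem_iUnion] at hx
  obtain ⟨d, hd, hx⟩ := hx
  have hcont : Continuous fun x : ℝ => (p : ℝ) * x - d := by fun_prop
  exact ⟨d, hd, hcont.closure_preimage_subset _ hx⟩

/-! ### Three-block digit sets and their cells -/

/-- Low minus low and high minus high are integer intervals through 0, whose union is the middle
block; the mixed differences are the outer blocks. -/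
theorem mem_digits_sub_digits {l₁ r₁ l₂ r₂ p : ℕ}
    (hl₁ : 1 ≤ l₁) (hr₁ : 1 ≤ r₁) (hl₂ : 1 ≤ l₂) (hr₂ : 1 ≤ r₂)
    (h₁ : l₁ + r₁ < p) (h₂ : l₂ + r₂ < p) (d : ℤ) :
    d ∈ digits l₁ r₁ p - digits l₂ r₂ p ↔
      (-p + 1 ≤ d ∧ d ≤ (l₁ : ℤ) + r₂ - p - 1) ∨
      (-(max l₂ r₁ : ℤ) + 1 ≤ d ∧ d ≤ (max l₁ r₂ : ℤ) - 1) ∨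
      ((p : ℤ) - (r₁ + l₂) + 1 ≤ d ∧ d ≤ (p : ℤ) - 1) := by
  simp only [Finset.mem_sub, digits, Finset.mem_union, Finset.mem_Icc]
  constructor
  · rintro ⟨y, hy, z, hz, rfl⟩
    omega
  · have key : ∀ a b c e : ℤ, a ≤ b → c ≤ e → a - e ≤ d → d ≤ b - c →
        ∃ y z, (a ≤ y ∧ y ≤ b) ∧ (c ≤ z ∧ z ≤ e) ∧ y - z = d := by
      intro a b c e hab hce h1 h2
      exact ⟨max a (d + c), max a (d + c) - d, by omega, by omega, by omega⟩
    have h5 : (max l₁ r₂ : ℤ) = l₁ ∧ (r₂ : ℤ) ≤ l₁ ∨ (max l₁ r₂ : ℤ) = r₂ ∧ (l₁ : ℤ) ≤ r₂ := by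
      omega
    have h6 : (max l₂ r₁ : ℤ) = l₂ ∧ (r₁ : ℤ) ≤ l₂ ∨ (max l₂ r₁ : ℤ) = r₁ ∧ (l₂ : ℤ) ≤ r₁ := by
      omega
    generalize (max l₁ r₂ : ℤ) = M at *
    generalize (max l₂ r₁ : ℤ) = m at *
    rintro (h | h | h)
    · obtain ⟨y, z, hy, hz, h⟩ := key 0 (l₁ - 1) (p - r₂) (p - 1) (by omega) (by omega)
        (by omega) (by omega)
      exact ⟨y, Or.inl hy, z, Or.inr hz, h⟩
    · by_cases hd : -(l₂ : ℤ) + 1 ≤ d ∧ d ≤ l₁ - 1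
      · obtain ⟨y, z, hy, hz, h⟩ := key 0 (l₁ - 1) 0 (l₂ - 1) (by omega) (by omega)
          (by omega) (by omega)
        exact ⟨y, Or.inl hy, z, Or.inl hz, h⟩
      · obtain ⟨y, z, hy, hz, h⟩ := key (p - r₁) (p - 1) (p - r₂) (p - 1) (by omega) (by omega)
          (by omega) (by omega)
        exact ⟨y, Or.inr hy, z, Or.inr hz, h⟩
    · obtain ⟨y, z, hy, hz, h⟩ := key (p - r₁) (p - 1) 0 (l₂ - 1) (by omega) (by omega)
        (by omega) (by omega)
      exact ⟨y, Or.inr hy, z, Or.inl hz, h⟩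

/-- The digits of the difference of two S-Cantor sets: three blocks of integers. -/
def IsDigit (p : ℕ) (a b m M d : ℤ) : Prop :=
  (-p + 1 ≤ d ∧ d ≤ a - p - 1) ∨ (-m + 1 ≤ d ∧ d ≤ M - 1) ∨ (p - b + 1 ≤ d ∧ d ≤ p - 1)

/-- `D` is the largest subset of `[-1, 1]` all of whose points can be expanded in base `p` with
the digits `IsDigit p a b m M`. -/
structure IsThreeBlockSet (p : ℕ) (a b m M : ℤ) (D : Set ℝ) : Prop where
  three_le : 3 ≤ p
  one_le_m : 1 ≤ m
  one_le_M : 1 ≤ M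
  m_lt : m < b
  M_lt : M < a
  b_le : b ≤ 2 * m
  a_le : a ≤ 2 * M
  m_le : m + 2 ≤ p
  M_le : M + 2 ≤ p
  closed : IsClosed D
  abs_le : ∀ x ∈ D, |x| ≤ 1
  mem_iff : ∀ x, x ∈ D ↔ ∃ d, IsDigit p a b m M d ∧ (p : ℝ) * x - d ∈ D
  subset : ∀ S : Set ℝ, (∀ x ∈ S, |x| ≤ 1) →
    (∀ x ∈ S, ∃ d, IsDigit p a b m M d ∧ (p : ℝ) * x - d ∈ S) → S ⊆ D

namespace IsThreeBlockSet

variable {p : ℕ} {a b m M : ℤ} {D : Set ℝ}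

theorem isDigit_neg {d : ℤ} (h : IsDigit p a b m M d) : IsDigit p b a M m (-d) := by
  unfold IsDigit at *
  omega

theorem neg (h : IsThreeBlockSet p a b m M D) : IsThreeBlockSet p b a M m (-D) where
  three_le := h.three_le
  one_le_m := h.one_le_M
  one_le_M := h.one_le_m
  m_lt := h.M_lt
  M_lt := h.m_lt
  b_le := h.a_le
  a_le := h.b_le
  m_le := h.M_le
  M_le := h.m_le
  closed := h.closed.neg
  abs_le x hx := by simpa using h.abs_le _ hx
  mem_iff x := by
    rw [Set.mem_neg, h.mem_iff]
    constructor
    · rintro ⟨d, hd, hx⟩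
      refine ⟨-d, isDigit_neg hd, ?_⟩
      rw [Set.mem_neg]
      convert hx using 1
      push_cast
      ring
    · rintro ⟨d, hd, hx⟩
      refine ⟨-d, isDigit_neg hd, ?_⟩
      rw [Set.mem_neg] at hx
      convert hx using 1
      push_cast
      ring
  subset S hS hd := by
    rw [← Set.neg_subset_neg, neg_neg]
    refine h.subset _ (fun x hx => by simpa using hS _ hx) fun x hx => ?_
    obtain ⟨d, hd, hx'⟩ := hd _ hx
    refine ⟨-d, isDigit_neg hd, ?_⟩
    rw [Set.mem_neg]
    convert hx' using 1
    push_cast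
    ring

theorem three_le_cast (h : IsThreeBlockSet p a b m M D) : (3 : ℝ) ≤ p := by
  exact_mod_cast h.three_le

theorem isDigit_last (h : IsThreeBlockSet p a b m M D) : IsDigit p a b m M ((p : ℤ) - 1) :=
  Or.inr (Or.inr ⟨by linarith [h.m_lt, h.one_le_m], le_rfl⟩)

theorem isDigit_first (h : IsThreeBlockSet p a b m M D) : IsDigit p a b m M (-(p : ℤ) + 1) :=
  Or.inl ⟨le_rfl, by linarith [h.M_lt, h.one_le_M]⟩

theorem isDigit_zero (h : IsThreeBlockSet p a b m M D) : IsDigit p a b m M 0 :=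
  Or.inr (Or.inl ⟨by linarith [h.one_le_m], by linarith [h.one_le_M]⟩)

theorem zero_mem (h : IsThreeBlockSet p a b m M D) : (0 : ℝ) ∈ D := by
  refine h.subset {0} (by simp) (fun x hx => ⟨0, h.isDigit_zero, ?_⟩) rfl
  rw [Set.mem_singleton_iff] at hx
  simp [hx]

theorem one_mem (h : IsThreeBlockSet p a b m M D) : (1 : ℝ) ∈ D := by
  refine h.subset {1} (by simp) (fun x hx => ⟨_, h.isDigit_last, ?_⟩) rfl
  rw [Set.mem_singleton_iff] at hx
  simp [hx]

theorem neg_one_mem (h : IsThreeBlockSet p a b m M D) : (-1 : ℝ) ∈ D := h.neg.one_mem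

theorem add_div_mem (h : IsThreeBlockSet p a b m M D) {d : ℤ} (hd : IsDigit p a b m M d) {z : ℝ}
    (hz : z ∈ D) : (d + z) / (p : ℝ) ∈ D := by
  have := h.three_le_cast
  refine (h.mem_iff _).2 ⟨d, hd, ?_⟩
  convert hz using 1
  field_simp
  ring

theorem le_one (h : IsThreeBlockSet p a b m M D) {x : ℝ} (hx : x ∈ D) : x ≤ 1 :=
  (_root_.abs_le.1 (h.abs_le x hx)).2

theorem neg_one_le (h : IsThreeBlockSet p a b m M D) {x : ℝ} (hx : x ∈ D) : -1 ≤ x :=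
  (_root_.abs_le.1 (h.abs_le x hx)).1

/-- As `D ⊆ [-1, 1]`, a leading digit differs from `p * x` by at most 1, which leaves only `k` and
`k + 1`. -/
theorem mem_cell_iff (h : IsThreeBlockSet p a b m M D) (k : ℤ) {y : ℝ} (hy0 : 0 < y)
    (hy1 : y < 1) : (k + y) / (p : ℝ) ∈ D ↔
      (IsDigit p a b m M k ∧ y ∈ D) ∨ (IsDigit p a b m M (k + 1) ∧ y - 1 ∈ D) := by
  have hp := h.three_le_cast
  constructor
  · intro hx
    obtain ⟨d, hd, hx⟩ := (h.mem_iff _).1 hx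
    rw [mul_div_cancel₀ _ (by linarith)] at hx
    have h1 := h.le_one hx
    have h2 := h.neg_one_le hx
    have h3 : k - 1 < d := by
      have : ((k - 1 : ℤ) : ℝ) < d := by push_cast; linarith
      exact_mod_cast this
    have h4 : d < k + 2 := by
      have : (d : ℝ) < ((k + 2 : ℤ) : ℝ) := by push_cast; linarith
      exact_mod_cast this
    obtain rfl | rfl : d = k ∨ d = k + 1 := by omega
    · exact Or.inl ⟨hd, by convert hx using 1; ring⟩
    · exact Or.inr ⟨hd, by convert hx using 1; push_cast; ring⟩
  · rintro (⟨hd, hy⟩ | ⟨hd, hy⟩)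
    · exact h.add_div_mem hd hy
    · convert h.add_div_mem hd hy using 1
      push_cast
      ring

/-- `p` is not a digit, so the last cell holds a single copy: this is the self-similarity of `D` at
1. -/
theorem last_cell_iff (h : IsThreeBlockSet p a b m M D) {y : ℝ} (hy0 : 0 < y) (hy1 : y < 1) :
    1 - (1 - y) / p ∈ D ↔ y ∈ D := by
  have hp := h.three_le_cast
  have heq : 1 - (1 - y) / (p : ℝ) = (((p : ℤ) - 1 : ℤ) + y) / (p : ℝ) := by
    push_cast
    field_simp
    ring
  have hno : ¬ IsDigit p a b m M ((p : ℤ) - 1 + 1) := by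
    have := h.a_le; have := h.M_le
    unfold IsDigit
    omega
  rw [heq, h.mem_cell_iff _ hy0 hy1]
  simp only [h.isDigit_last, hno, true_and, false_and, or_false]

/-- The integer `w` encodes the first `n` digits of `x`, after which any tail from `D` is allowed.
-/
theorem exists_zoom (h : IsThreeBlockSet p a b m M D) (n : ℕ) {x : ℝ} (hx : x ∈ D) :
    ∃ w : ℤ, (p : ℝ) ^ n * x - w ∈ D ∧ ∀ z ∈ D, (w + z) / (p : ℝ) ^ n ∈ D := by
  have hp := h.three_le_cast
  induction n with
  | zero => exact ⟨0, by simpa using hx, fun z hz => by simpa using hz⟩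
  | succ n ih =>
    obtain ⟨w, hw, hz⟩ := ih
    obtain ⟨d, hd, hd'⟩ := (h.mem_iff _).1 hw
    refine ⟨p * w + d, ?_, fun z hzD => ?_⟩
    · convert hd' using 1
      push_cast
      ring
    · convert hz _ (h.add_div_mem hd hzD) using 1
      push_cast
      field_simp
      ring

theorem exists_pow_gt (h : IsThreeBlockSet p a b m M D) {δ : ℝ} (hδ : 0 < δ) (c : ℝ) :
    ∃ n : ℕ, c < (p : ℝ) ^ n * δ := by
  have hp := h.three_le_cast
  obtain ⟨n, hn⟩ := pow_unbounded_of_one_lt (c / δ) (by linarith : (1 : ℝ) < p)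
  exact ⟨n, by rwa [div_lt_iff₀ hδ] at hn⟩

/-! ### Perfectness and the Cantor case -/

/-- Keep `n` digits of `x` and replace the tail by 0, or by 1 if the tail was 0. -/
theorem perfect (h : IsThreeBlockSet p a b m M D) : Perfect D := by
  have hp := h.three_le_cast
  refine ⟨h.closed, fun x hx => ?_⟩
  rw [accPt_iff_nhds]
  intro U hU
  obtain ⟨ε, hε, hs⟩ := Metric.mem_nhds_iff.1 hU
  obtain ⟨n, hn⟩ := h.exists_pow_gt hε 2
  obtain ⟨w, hw, hz⟩ := h.exists_zoom n hx
  have hpn : (0 : ℝ) < (p : ℝ) ^ n := by positivity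
  have key : ∀ z ∈ D, (p : ℝ) ^ n * x - w ≠ z → ∃ y ∈ U ∩ D, y ≠ x := by
    intro z hzD hne
    refine ⟨(w + z) / (p : ℝ) ^ n, ⟨hs ?_, hz z hzD⟩, ?_⟩
    · rw [Metric.mem_ball, Real.dist_eq,
        show (w + z) / (p : ℝ) ^ n - x = (z - ((p : ℝ) ^ n * x - w)) / (p : ℝ) ^ n by
          field_simp; ring, abs_div, abs_of_pos hpn, div_lt_iff₀ hpn]
      have h1 := h.abs_le _ hzD
      have h2 := h.abs_le _ hw
      have h3 := abs_sub z ((p : ℝ) ^ n * x - w)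
      linarith
    · intro heq
      apply hne
      rw [← heq]
      field_simp
      ring
  by_cases h1 : (p : ℝ) ^ n * x - w = 0
  · exact key 1 h.one_mem (by rw [h1]; norm_num)
  · exact key 0 h.zero_mem h1

/-- If `D` has interior points, then its integer translates cover the line. -/
theorem exists_add_mem_of_Icc_subset (h : IsThreeBlockSet p a b m M D) {s t : ℝ} (hst : s < t)
    (hs : Set.Icc s t ⊆ D) (x : ℝ) : ∃ j : ℤ, x + j ∈ D := by
  have hp := h.three_le_cast
  -- Magnified by `p ^ n`, the interval is longer than 1 and so meets `x + ℤ`.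
  obtain ⟨n, hn⟩ := h.exists_pow_gt (sub_pos.2 hst) 1
  have hpn : (0 : ℝ) < (p : ℝ) ^ n := by positivity
  have h1 := Int.le_ceil ((p : ℝ) ^ n * s - x)
  have h2 := Int.ceil_lt_add_one ((p : ℝ) ^ n * s - x)
  set k := ⌈(p : ℝ) ^ n * s - x⌉
  have hmem : (x + k) / (p : ℝ) ^ n ∈ D := by
    refine hs ⟨?_, ?_⟩
    · rw [le_div_iff₀ hpn]
      linarith
    · rw [div_le_iff₀ hpn]
      linarith
  obtain ⟨w, hw, -⟩ := h.exists_zoom n hmem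
  refine ⟨k - w, ?_⟩
  convert hw using 1
  push_cast
  field_simp
  ring

/-- The residue `a` is missing mod `p`, so among the integer translates of cell `a - 1` only cell `a
- 1 - p` can meet `D`, in a copy of `D ∩ (0, 1)`. Covering forces this copy to be full, yet cell `M`
has no digit. -/
theorem not_Icc_subset (h : IsThreeBlockSet p a b m M D) (h3 : a + b ≤ p) {s t : ℝ}
    (hst : s < t) : ¬ Set.Icc s t ⊆ D := by
  intro hs
  have hp := h.three_le_cast
  have hcov := h.exists_add_mem_of_Icc_subset hst hs
  have hm := h.one_le_m; have hM := h.one_le_M; have hmb := h.m_lt; have hMa := h.M_lt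
  have hb := h.b_le; have ha := h.a_le
  have hhalf : ∀ y : ℝ, 0 < y → y < 1 → y ∈ D := by
    intro y hy0 hy1
    have hap : (a : ℝ) ≤ p := by exact_mod_cast (by omega : a ≤ p)
    have ha1 : (1 : ℝ) ≤ a := by exact_mod_cast (by omega : 1 ≤ a)
    obtain ⟨j, hj⟩ := hcov ((((a - 1 : ℤ) : ℝ) + y) / p)
    have hx0 : 0 < (((a - 1 : ℤ) : ℝ) + y) / (p : ℝ) := by
      push_cast
      apply div_pos <;> linarith
    have hx1 : (((a - 1 : ℤ) : ℝ) + y) / (p : ℝ) < 1 := by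
      push_cast
      rw [div_lt_one (by linarith)]
      linarith
    have hj1 := h.le_one hj
    have hj2 := h.neg_one_le hj
    have h5 : -2 < j := by
      have : ((-2 : ℤ) : ℝ) < j := by push_cast; linarith
      exact_mod_cast this
    have h6 : j < 1 := by
      have : (j : ℝ) < (1 : ℤ) := by push_cast; linarith
      exact_mod_cast this
    obtain rfl | rfl : j = 0 ∨ j = -1 := by omega
    · rw [Int.cast_zero, add_zero, h.mem_cell_iff _ hy0 hy1] at hj
      unfold IsDigit at hj
      omega
    · have heq : (((a - 1 : ℤ) : ℝ) + y) / (p : ℝ) + ((-1 : ℤ) : ℝ) =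
          (((a - 1 - p : ℤ) : ℝ) + y) / (p : ℝ) := by
        push_cast
        field_simp
        ring
      rw [heq, h.mem_cell_iff _ hy0 hy1] at hj
      rcases hj with ⟨-, hj⟩ | ⟨hj, -⟩
      · exact hj
      · unfold IsDigit at hj
        omega
  have hMp : (M : ℝ) + 1 ≤ p := by exact_mod_cast (by omega : M + 1 ≤ p)
  have hM1 : (1 : ℝ) ≤ M := by exact_mod_cast hM
  have := hhalf ((M + 1 / 2) / p) (by positivity) (by rw [div_lt_one (by linarith)]; linarith)
  rw [h.mem_cell_iff _ (by norm_num) (by norm_num)] at this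
  unfold IsDigit at this
  omega

theorem isCantorSet (h : IsThreeBlockSet p a b m M D) (h3 : a + b ≤ p) : IsCantorSet D where
  nonempty := ⟨0, h.zero_mem⟩
  bounded := (Metric.isBounded_Icc (-1 : ℝ) 1).subset fun _ hx => ⟨h.neg_one_le hx, h.le_one hx⟩
  perfect := h.perfect
  nowhereDense := by
    rw [h.closed.isNowhereDense_iff, Set.eq_empty_iff_forall_notMem]
    intro x hx
    obtain ⟨ε, hε, hs⟩ := Metric.isOpen_iff.1 isOpen_interior x hx
    refine h.not_Icc_subset h3 (s := x) (t := x + ε / 2) (by linarith) fun y hy =>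
      interior_subset (hs ?_)
    rw [Metric.mem_ball, Real.dist_eq, abs_lt]
    constructor <;> linarith [hy.1, hy.2]

/-! ### Covering by integer translates when (S3) fails -/

theorem exists_int_div_mem (h : IsThreeBlockSet p a b m M D) (h3 : p < a + b) (n : ℕ) :
    ∀ k : ℤ, ∃ j : ℤ, ∀ z ∈ D, (k + z) / (p : ℝ) ^ n - j ∈ D := by
  have hp := h.three_le_cast
  induction n with
  | zero => exact fun k => ⟨k, fun z hz => by simpa using hz⟩
  | succ n ih =>
    intro k
    have hd : ∃ d q, IsDigit p a b m M d ∧ k = d + p * q := by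
      have hm := h.one_le_m; have hM := h.one_le_M
      have hp3 := h.three_le
      have h1 := Int.emod_add_mul_ediv k p
      have h2 := Int.emod_nonneg k (by omega : (p : ℤ) ≠ 0)
      have h3 := Int.emod_lt_of_pos k (by omega : 0 < (p : ℤ))
      -- The residues `1, …, a - 1` come from the first block, the remaining nonzero ones from the
      -- last, since `p < a + b`.
      by_cases h0 : k % p = 0
      · exact ⟨0, k / p, h.isDigit_zero, by omega⟩
      by_cases h4 : k % p ≤ a - 1
      · refine ⟨k % p - p, k / p + 1, ?_, by linarith⟩
        unfold IsDigit
        omega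
      · refine ⟨k % p, k / p, ?_, by linarith⟩
        unfold IsDigit
        omega
    obtain ⟨d, q, hd, rfl⟩ := hd
    obtain ⟨j, hj⟩ := ih q
    refine ⟨j, fun z hz => ?_⟩
    convert hj _ (h.add_div_mem hd hz) using 1
    push_cast
    field_simp
    ring

/-- The dense points `k / p ^ n` lie in `D` up to an integer, and `D` is closed. -/
theorem mem_or_sub_one_mem (h : IsThreeBlockSet p a b m M D) (h3 : p < a + b) {x : ℝ}
    (hx0 : 0 < x) (hx1 : x < 1) : x ∈ D ∨ x - 1 ∈ D := by
  have hp := h.three_le_cast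
  have hcl : IsClosed (D ∪ (fun y : ℝ => y - 1) ⁻¹' D) :=
    h.closed.union (h.closed.preimage (by fun_prop))
  suffices hs : x ∈ closure (D ∪ (fun y : ℝ => y - 1) ⁻¹' D) by
    rwa [hcl.closure_eq] at hs
  rw [Metric.mem_closure_iff]
  intro ε hε
  -- The bound `1 - x` keeps `k / p ^ n` below 1, so that the integer can only be 0 or 1.
  obtain ⟨n, hn⟩ := h.exists_pow_gt (lt_min hε (sub_pos.2 hx1)) 1
  have hpn : (0 : ℝ) < (p : ℝ) ^ n := by positivity
  have h1 := Int.le_ceil ((p : ℝ) ^ n * x)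
  have h2 := Int.ceil_lt_add_one ((p : ℝ) ^ n * x)
  set k := ⌈(p : ℝ) ^ n * x⌉
  obtain ⟨j, hj⟩ := h.exists_int_div_mem h3 n k
  have hj := hj 0 h.zero_mem
  rw [add_zero] at hj
  have h4 : x ≤ k / (p : ℝ) ^ n := by
    rw [le_div_iff₀ hpn]
    linarith
  have h5 : k / (p : ℝ) ^ n < x + min ε (1 - x) := by
    rw [div_lt_iff₀ hpn]
    linarith
  have h6 := min_le_left ε (1 - x)
  have h7 := min_le_right ε (1 - x)
  have hj1 := h.le_one hj
  have hj2 := h.neg_one_le hj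
  have hj3 : -1 < j := by
    have : ((-1 : ℤ) : ℝ) < j := by push_cast; linarith
    exact_mod_cast this
  have hj4 : j < 2 := by
    have : (j : ℝ) < (2 : ℤ) := by push_cast; linarith
    exact_mod_cast this
  refine ⟨k / (p : ℝ) ^ n, ?_, ?_⟩
  · obtain rfl | rfl : j = 0 ∨ j = 1 := by omega
    · exact Or.inl (by simpa using hj)
    · exact Or.inr (by simpa using hj)
  · rw [Real.dist_eq, abs_lt]
    constructor <;> linarith

theorem cell_subset (h : IsThreeBlockSet p a b m M D) (h3 : p < a + b) {k : ℤ}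
    (hk : IsDigit p a b m M k) (hk' : IsDigit p a b m M (k + 1)) {y : ℝ} (hy0 : 0 < y)
    (hy1 : y < 1) : (k + y) / (p : ℝ) ∈ D := by
  rw [h.mem_cell_iff k hy0 hy1]
  rcases h.mem_or_sub_one_mem h3 hy0 hy1 with h | h
  · exact Or.inl ⟨hk, h⟩
  · exact Or.inr ⟨hk', h⟩

/-! ### Left endpoints of gaps -/

/-- Near `u`, on the left, `D` looks like a scaled copy of `D ∩ [0, 1]` near `1`. -/
def IsLeftType (D : Set ℝ) (u : ℝ) : Prop :=
  ∃ s > 0, ∀ y, 0 < y → y < 1 → (u - (1 - y) * s ∈ D ↔ y ∈ D)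

/-- Each use of `last_cell_iff` divides the scale by `p`. -/
theorem exists_scale_lt (h : IsThreeBlockSet p a b m M D) {u : ℝ} (hu : IsLeftType D u) {δ : ℝ}
    (hδ : 0 < δ) : ∃ s > 0, s < δ ∧ ∀ y, 0 < y → y < 1 → (u - (1 - y) * s ∈ D ↔ y ∈ D) := by
  have hp := h.three_le_cast
  obtain ⟨s, hs, hu⟩ := hu
  have key : ∀ n : ℕ, ∀ y, 0 < y → y < 1 → (u - (1 - y) * (s / (p : ℝ) ^ n) ∈ D ↔ y ∈ D) := by
    intro n
    induction n with
    | zero => simpa using hu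
    | succ n ih =>
      intro y hy0 hy1
      rw [← h.last_cell_iff hy0 hy1]
      have h1 : (1 - y) / (p : ℝ) < 1 := by
        rw [div_lt_one (by linarith)]
        linarith
      have h2 : 0 < (1 - y) / (p : ℝ) := div_pos (by linarith) (by linarith)
      rw [← ih (1 - (1 - y) / p) (by linarith) (by linarith)]
      have : u - (1 - y) * (s / (p : ℝ) ^ (n + 1)) =
          u - (1 - (1 - (1 - y) / p)) * (s / (p : ℝ) ^ n) := by
        field_simp
        ring
      rw [this]
  obtain ⟨n, hn⟩ := h.exists_pow_gt hδ s
  have hpn : (0 : ℝ) < (p : ℝ) ^ n := by positivity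
  exact ⟨s / (p : ℝ) ^ n, by positivity, by rw [div_lt_iff₀ hpn]; linarith, key n⟩

/-- The points `1 / p ^ n` of `D` decrease to 0. Together with the analogue at `-1`, this keeps the
left endpoint of a magnified gap off the left end of its cell. -/
theorem not_isGapIoo_zero (h : IsThreeBlockSet p a b m M D) (v : ℝ) : ¬ IsGapIoo D 0 v := by
  intro hg
  have hp := h.three_le_cast
  obtain ⟨n, hn⟩ := h.exists_pow_gt hg.lt 1
  have hpn : (0 : ℝ) < (p : ℝ) ^ n := by positivity
  have hmem : ∀ n : ℕ, 1 / (p : ℝ) ^ n ∈ D := by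
    intro n
    induction n with
    | zero => simpa using h.one_mem
    | succ n ih =>
      convert h.add_div_mem h.isDigit_zero ih using 1
      push_cast
      field_simp
      ring
  exact hg.notMem _ (by positivity) (by rw [div_lt_iff₀ hpn]; linarith) (hmem n)

theorem not_isGapIoo_neg_one (h : IsThreeBlockSet p a b m M D) (v : ℝ) :
    ¬ IsGapIoo D (-1) v := by
  intro hg
  have hp := h.three_le_cast
  obtain ⟨n, hn⟩ := h.exists_pow_gt (by linarith [hg.lt] : 0 < v + 1) 2
  have hpn : (0 : ℝ) < (p : ℝ) ^ n := by positivity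
  have hmem : ∀ n : ℕ, -1 + 2 / (p : ℝ) ^ n ∈ D := by
    intro n
    induction n with
    | zero => convert h.one_mem using 1; norm_num
    | succ n ih =>
      convert h.add_div_mem h.isDigit_first ih using 1
      push_cast
      field_simp
      ring
  have h1 : 0 < 2 / (p : ℝ) ^ n := by positivity
  have h2 : 2 / (p : ℝ) ^ n < v + 1 := by rw [div_lt_iff₀ hpn]; linarith
  exact hg.notMem _ (by linarith) (by linarith) (hmem n)

/-- The only leading digit left for `u` is `k - 1`, which forces `p * u = k`; as `k` is no digit,
the cell ending at `u` is a single copy of `D ∩ (0, 1)`. -/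
theorem isLeftType_of_not_isDigit (h : IsThreeBlockSet p a b m M D) {u : ℝ} (hu : u ∈ D) {k : ℤ}
    (hk1 : k ≤ p * u) (hk2 : p * u < k + 1) (hk : ¬ IsDigit p a b m M k)
    (hk' : ¬ IsDigit p a b m M (k + 1)) : IsLeftType D u := by
  have hp := h.three_le_cast
  have hp0 : (p : ℝ) ≠ 0 := by linarith
  obtain ⟨d, hd, hx⟩ := (h.mem_iff _).1 hu
  have h1 := h.le_one hx
  have h2 := h.neg_one_le hx
  have hdk : k - 1 ≤ d := by
    have : ((k - 1 : ℤ) : ℝ) ≤ d := by push_cast; linarith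
    exact_mod_cast this
  have hdk' : d < k + 2 := by
    have : (d : ℝ) < (k + 2 : ℤ) := by push_cast; linarith
    exact_mod_cast this
  have hne : d ≠ k := fun h => hk (h ▸ hd)
  have hne' : d ≠ k + 1 := fun h => hk' (h ▸ hd)
  obtain rfl : k = d + 1 := by omega
  have hpu : (p : ℝ) * u = d + 1 := by push_cast at hk1; linarith
  refine ⟨1 / p, by positivity, fun y hy0 hy1 => ?_⟩
  have : u - (1 - y) * (1 / p) = (d + y) / (p : ℝ) := by
    field_simp
    linarith
  rw [this, h.mem_cell_iff d hy0 hy1]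
  simp [hd, hk]

/-- Induction on the scale: magnifying a gap inside its cell uses up one power of `p`, and no gap is
longer than 2. -/
theorem isLeftType_of_isGapIoo_of_lt (h : IsThreeBlockSet p a b m M D) (h3 : p < a + b) (n : ℕ) :
    ∀ u v, IsGapIoo D u v → 2 < (p : ℝ) ^ n * (v - u) → IsLeftType D u := by
  have hp := h.three_le_cast
  have hp0 : (p : ℝ) ≠ 0 := by linarith
  have hppos : (0 : ℝ) < p := by linarith
  induction n with
  | zero =>
    intro u v hg hlt
    have := h.le_one hg.right_mem
    have := h.neg_one_le hg.left_mem
    rw [pow_zero, one_mul] at hlt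
    linarith
  | succ n ih =>
    intro u v hg hlt
    have hk1 := Int.floor_le ((p : ℝ) * u)
    have hk2 := Int.lt_floor_add_one ((p : ℝ) * u)
    set k := ⌊(p : ℝ) * u⌋
    have huv : (p : ℝ) * u < p * v := mul_lt_mul_of_pos_left hg.lt hppos
    -- If the gap contains `(k + 1) / p`, neither `k` (with tail 1) nor `k + 1` (with tail 0) can be
    -- a digit.
    by_cases hkv : (k : ℝ) + 1 < p * v
    · have hno : (k + 1 : ℝ) / p ∉ D :=
        hg.notMem _ (by rw [lt_div_iff₀ hppos]; linarith) (by rw [div_lt_iff₀ hppos]; linarith)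
      refine h.isLeftType_of_not_isDigit hg.left_mem hk1 hk2 (fun hd => hno ?_) fun hd => hno ?_
      · exact h.add_div_mem hd h.one_mem
      · have := h.add_div_mem hd h.zero_mem
        push_cast at this
        simpa using this
    rw [not_lt] at hkv
    have hdiv : ∀ y : ℝ, p * u - k < y → y < p * v - k → (k + y) / (p : ℝ) ∉ D := fun y h1 h2 =>
      hg.notMem _ (by rw [lt_div_iff₀ hppos]; linarith) (by rw [div_lt_iff₀ hppos]; linarith)
    have hcu : 0 < p * u - k →
        (IsDigit p a b m M k ∧ p * u - k ∈ D) ∨ (IsDigit p a b m M (k + 1) ∧ p * u - k - 1 ∈ D) := by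
      intro h0
      rw [← h.mem_cell_iff k h0 (by linarith)]
      convert hg.left_mem using 1
      field_simp
      ring
    have hcv : p * v - k < 1 →
        (IsDigit p a b m M k ∧ p * v - k ∈ D) ∨ (IsDigit p a b m M (k + 1) ∧ p * v - k - 1 ∈ D) := by
      intro h0
      rw [← h.mem_cell_iff k (by linarith) h0]
      convert hg.right_mem using 1
      field_simp
      ring
    have hlt' : 2 < (p : ℝ) ^ n * (p * v - p * u) := by
      rw [pow_succ] at hlt
      linarith
    by_cases hd : IsDigit p a b m M k <;> by_cases hd' : IsDigit p a b m M (k + 1)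
    · obtain ⟨y, hy1, hy2⟩ := exists_between huv
      exact absurd (h.cell_subset h3 hd hd' (y := y - k) (by linarith) (by linarith))
        (hdiv _ (by linarith) (by linarith))
    · simp only [hd, hd', true_and, false_and, or_false] at hcu hcv
      have hg' : IsGapIoo D (p * u - k) (p * v - k) := by
        refine ⟨by linarith, ?_, ?_, fun y hy1 hy2 hy => ?_⟩
        · rcases eq_or_lt_of_le (sub_nonneg.2 hk1) with h0 | h0
          · rw [← h0]; exact h.zero_mem
          · exact hcu h0
        · rcases eq_or_lt_of_le (by linarith : p * v - k ≤ 1) with h0 | h0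
          · rw [h0]; exact h.one_mem
          · exact hcv h0
        · exact hdiv y hy1 hy2 (h.add_div_mem hd hy)
      have h0 : 0 < p * u - k := by
        refine lt_of_le_of_ne (by linarith) fun h0 => ?_
        rw [← h0] at hg'
        exact h.not_isGapIoo_zero _ hg'
      -- A scale below `p * u - k` keeps the left neighbourhood within the cell.
      obtain ⟨s, hs, hs1, hsy⟩ := h.exists_scale_lt (ih _ _ hg' (by linarith)) h0
      refine ⟨s / p, by positivity, fun y hy0 hy1 => ?_⟩
      have h4 : 0 < (1 - y) * s := mul_pos (by linarith) hs
      have h5 : (1 - y) * s < s := mul_lt_of_lt_one_left hs (by linarith)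
      have heq : u - (1 - y) * (s / p) = (k + (p * u - k - (1 - y) * s)) / (p : ℝ) := by
        field_simp
        ring
      rw [heq, h.mem_cell_iff k (by linarith) (by linarith), ← hsy y hy0 hy1]
      simp [hd, hd']
    · simp only [hd, hd', true_and, false_and, false_or] at hcu hcv
      have hg' : IsGapIoo D (p * u - k - 1) (p * v - k - 1) := by
        refine ⟨by linarith, ?_, ?_, fun y hy1 hy2 hy => ?_⟩
        · rcases eq_or_lt_of_le (sub_nonneg.2 hk1) with h0 | h0
          · rw [← h0, zero_sub]; exact h.neg_one_mem
          · exact hcu h0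
        · rcases eq_or_lt_of_le (by linarith : p * v - k ≤ 1) with h0 | h0
          · rw [h0, sub_self]; exact h.zero_mem
          · exact hcv h0
        · refine hdiv (y + 1) (by linarith) (by linarith) ?_
          convert h.add_div_mem hd' hy using 1
          push_cast
          ring
      have h0 : 0 < p * u - k := by
        refine lt_of_le_of_ne (by linarith) fun h0 => ?_
        rw [← h0, zero_sub] at hg'
        exact h.not_isGapIoo_neg_one _ hg'
      obtain ⟨s, hs, hs1, hsy⟩ := h.exists_scale_lt (ih _ _ hg' (by linarith)) h0
      refine ⟨s / p, by positivity, fun y hy0 hy1 => ?_⟩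
      have h4 : 0 < (1 - y) * s := mul_pos (by linarith) hs
      have h5 : (1 - y) * s < s := mul_lt_of_lt_one_left hs (by linarith)
      have heq : u - (1 - y) * (s / p) = (k + (p * u - k - (1 - y) * s)) / (p : ℝ) := by
        field_simp
        ring
      rw [heq, h.mem_cell_iff k (by linarith) (by linarith), ← hsy y hy0 hy1]
      simp [hd, hd', sub_right_comm]
    · exact h.isLeftType_of_not_isDigit hg.left_mem hk1 hk2 hd hd'

theorem isLeftType_of_isGapIoo (h : IsThreeBlockSet p a b m M D) (h3 : p < a + b) {u v : ℝ}
    (hg : IsGapIoo D u v) : IsLeftType D u := by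
  obtain ⟨n, hn⟩ := h.exists_pow_gt (sub_pos.2 hg.lt) 2
  exact h.isLeftType_of_isGapIoo_of_lt h3 n u v hg hn

/-- At three shrinking scales `σ`, `τ`, `ρ` one places copies of `c`, of `[s, t]` and of `c` again;
the ratios `1 - c` and `1 - t` keep them in this order. -/
theorem isAccumulated_of_isLeftType (h : IsThreeBlockSet p a b m M D)
    (hc : ∃ c, 0 < c ∧ c < 1 ∧ c ∉ D)
    (hi : ∃ s t, 0 < s ∧ s < t ∧ t < 1 ∧ Set.Icc s t ⊆ D)
    {u : ℝ} (hu : u ∈ D) (hL : IsLeftType D u) : IsAccumulated D u := by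
  obtain ⟨c, hc0, hc1, hc⟩ := hc
  obtain ⟨s, t, hs0, hst, ht1, hs⟩ := hi
  refine isAccumulated_of_left h.closed hu fun ε hε => ?_
  obtain ⟨σ, hσ, hσε, hσD⟩ := h.exists_scale_lt hL hε
  obtain ⟨τ, hτ, hτσ, hτD⟩ := h.exists_scale_lt hL (mul_pos (sub_pos.2 hc1) hσ)
  obtain ⟨ρ, hρ, hρτ, hρD⟩ := h.exists_scale_lt hL (mul_pos (sub_pos.2 ht1) hτ)
  refine ⟨u - (1 - c) * σ, u - (1 - s) * τ, u - (1 - t) * τ, u - (1 - c) * ρ, ?_, ?_, ?_, ?_, ?_,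
    ?_, ?_, ?_⟩
  · nlinarith
  · nlinarith
  · nlinarith
  · nlinarith
  · nlinarith
  · rwa [hσD c hc0 hc1]
  · rwa [hρD c hc0 hc1]
  · rintro y ⟨hy1, hy2⟩
    have hy : y = u - (1 - (1 - (u - y) / τ)) * τ := by
      field_simp
      ring
    have h1 : s ≤ 1 - (u - y) / τ := by
      have : (u - y) / τ ≤ 1 - s := by rw [div_le_iff₀ hτ]; linarith
      linarith
    have h2 : 1 - (u - y) / τ ≤ t := by
      have : 1 - t ≤ (u - y) / τ := by rw [le_div_iff₀ hτ]; linarith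
      linarith
    rw [hy, hτD _ (by linarith) (by linarith)]
    exact hs ⟨h1, h2⟩

/-! ### The M-Cantorval case -/

/-- Both `M` and `M + 1` are missing, so cell `M` is empty. -/
theorem exists_notMem (h : IsThreeBlockSet p a b m M D) (h2 : b + M < p) :
    ∃ c, 0 < c ∧ c < 1 ∧ c ∉ D := by
  have hp := h.three_le_cast
  have hm := h.one_le_m; have hM := h.one_le_M; have hmb := h.m_lt
  have ha := h.a_le; have hMp := h.M_le
  have hMp : (M : ℝ) + 1 ≤ p := by exact_mod_cast (by omega : M + 1 ≤ p)
  have hM1 : (1 : ℝ) ≤ M := by exact_mod_cast hM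
  refine ⟨(M + 1 / 2) / p, by positivity, by rw [div_lt_one (by linarith)]; linarith, fun hc => ?_⟩
  rw [h.mem_cell_iff _ (by norm_num) (by norm_num)] at hc
  unfold IsDigit at hc
  omega

/-- If `b + M = p`, only `M` is missing, so cell `M` is a copy of `D ∩ (-1, 0)`; this omits a point
by the mirrored case `a + m < p`. -/
theorem exists_notMem_of_le (h : IsThreeBlockSet p a b m M D) (h1 : a + m ≤ p) (h2 : b + M ≤ p)
    (hne : a + m < p ∨ b + M < p) : ∃ c, 0 < c ∧ c < 1 ∧ c ∉ D := by
  rcases lt_or_ge (b + M) p with hlt | hge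
  · exact h.exists_notMem hlt
  have hp := h.three_le_cast
  have hm := h.one_le_m; have hM := h.one_le_M; have hmb := h.m_lt; have hMa := h.M_lt
  obtain ⟨c, hc0, hc1, hc⟩ := h.neg.exists_notMem (by omega)
  have hMp : (M : ℝ) + 1 ≤ p := by exact_mod_cast (by omega : M + 1 ≤ p)
  have hM1 : (1 : ℝ) ≤ M := by exact_mod_cast hM
  refine ⟨(M + (1 - c)) / p, div_pos (by linarith) (by linarith),
    by rw [div_lt_one (by linarith)]; linarith, fun hx => ?_⟩
  rw [h.mem_cell_iff _ (by linarith) (by linarith)] at hx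
  rcases hx with ⟨hx, -⟩ | ⟨-, hx⟩
  · unfold IsDigit at hx
    omega
  · exact hc (by rw [Set.mem_neg]; convert hx using 1; ring)

theorem exists_Icc_subset (h : IsThreeBlockSet p a b m M D) (h3 : p < a + b)
    (h2 : b + M ≤ p) (hne : a + m < p ∨ b + M < p) :
    ∃ s t, 0 < s ∧ s < t ∧ t < 1 ∧ Set.Icc s t ⊆ D := by
  have hp := h.three_le_cast
  have hp3 := h.three_le
  have hm := h.one_le_m; have hM := h.one_le_M; have hmb := h.m_lt; have hMa := h.M_lt
  have hb := h.b_le; have ha := h.a_le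
  obtain ⟨d, hd0, hd1, hd, hd'⟩ : ∃ d : ℤ, 0 ≤ d ∧ d + 2 ≤ p ∧ IsDigit p a b m M d ∧
      IsDigit p a b m M (d + 1) := by
    -- Two adjacent digits fill a cell. If `M = 1`, then `a = 2` and `b = p - 1`, and `hne` rules
    -- out `p = 3`, so `p - 2` is a digit.
    by_cases hM2 : 2 ≤ M
    · refine ⟨0, le_rfl, by omega, h.isDigit_zero, ?_⟩
      unfold IsDigit
      omega
    · refine ⟨p - 2, by omega, by omega, ?_, ?_⟩ <;> unfold IsDigit <;> omega
  have hd0' : (0 : ℝ) ≤ d := by exact_mod_cast hd0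
  have hd1' : (d : ℝ) + 2 ≤ p := by exact_mod_cast hd1
  refine ⟨(d + 1 / 4) / p, (d + 1 / 2) / p, by positivity, by gcongr; norm_num,
    by rw [div_lt_one (by linarith)]; linarith, fun y ⟨hy1, hy2⟩ => ?_⟩
  rw [div_le_iff₀ (by linarith)] at hy1
  rw [le_div_iff₀ (by linarith)] at hy2
  have := h.cell_subset h3 hd hd' (y := y * p - d) (by linarith) (by linarith)
  convert this using 1
  field_simp
  ring

theorem isAccumulated_left (h : IsThreeBlockSet p a b m M D) (h3 : p < a + b)
    (h1 : a + m ≤ p) (h2 : b + M ≤ p) (hne : a + m < p ∨ b + M < p) {u v : ℝ}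
    (hg : IsGapIoo D u v) : IsAccumulated D u :=
  h.isAccumulated_of_isLeftType (h.exists_notMem_of_le h1 h2 hne)
    (h.exists_Icc_subset h3 h2 hne) hg.left_mem (h.isLeftType_of_isGapIoo h3 hg)

theorem isMCantorval (h : IsThreeBlockSet p a b m M D) (h3 : p < a + b)
    (h1 : a + m ≤ p) (h2 : b + M ≤ p) (hne : a + m < p ∨ b + M < p) : IsMCantorval D where
  perfect := h.perfect
  infinite_gaps := by
    obtain ⟨c, hc0, hc1, hc⟩ := h.exists_notMem_of_le h1 h2 hne
    obtain ⟨u, v, hg, -⟩ := exists_isGapIoo h.closed h.zero_mem h.one_mem hc hc0 hc1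
    exact infinite_isGap_of_isAccumulated h.closed hg fun u v hg =>
      h.isAccumulated_left h3 h1 h2 hne hg
  left_endpoint G hG x hx := by
    obtain ⟨u, v, hg, rfl⟩ := hG.exists_eq_Ioo h.closed
    rw [hx.unique hg.isGLB]
    exact h.isAccumulated_left h3 h1 h2 hne hg
  right_endpoint G hG x hx := by
    obtain ⟨u, v, hg, rfl⟩ := hG.exists_eq_Ioo h.closed
    rw [hx.unique hg.isLUB]
    simpa using (h.neg.isAccumulated_left (by omega) h2 h1 hne.symm hg.neg).neg

/-! ### The L-Cantorval and interval cases -/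

/-- All of `-p + 1, …, 0` are digits, so `⌈p * x⌉` serves, except at `x = -1`, where it is `-p`. -/
theorem Icc_neg_one_zero_subset (h : IsThreeBlockSet p a b m M D) (h1 : p < a + m) :
    Set.Icc (-1 : ℝ) 0 ⊆ D := by
  have hp := h.three_le_cast
  have hm := h.one_le_m; have hM := h.one_le_M
  refine h.subset _ (fun x hx => _root_.abs_le.2 ⟨hx.1, hx.2.trans zero_le_one⟩) fun x hx => ?_
  have hk1 := Int.le_ceil ((p : ℝ) * x)
  have hk2 := Int.ceil_lt_add_one ((p : ℝ) * x)
  have hx0 : (p : ℝ) * x ≤ 0 := mul_nonpos_of_nonneg_of_nonpos (by linarith) hx.2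
  have hx1 : -(p : ℝ) ≤ p * x := by nlinarith [hx.1]
  have hk0 : ⌈(p : ℝ) * x⌉ ≤ 0 := Int.ceil_le.2 (by simpa using hx0)
  rcases le_or_gt (-(p : ℤ) + 1) ⌈(p : ℝ) * x⌉ with hle | hlt
  · refine ⟨⌈(p : ℝ) * x⌉, ?_, by linarith, by linarith⟩
    unfold IsDigit
    omega
  · refine ⟨_, h.isDigit_first, ?_, ?_⟩
    · push_cast
      linarith
    · have : (⌈(p : ℝ) * x⌉ : ℝ) ≤ (-(p : ℤ) : ℤ) := by exact_mod_cast (by omega)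
      push_cast at *
      linarith

theorem isLCantorval (h : IsThreeBlockSet p a b m M D) (h1 : p < a + m) (h2 : b + M < p) :
    IsLCantorval D := by
  have hp := h.three_le_cast
  have h3 : p < a + b := by have := h.m_lt; omega
  have hsub := h.Icc_neg_one_zero_subset h1
  have hi : ∃ s t, 0 < s ∧ s < t ∧ t < 1 ∧ Set.Icc s t ⊆ D := by
    -- The digit `p - 1` with tails in `[-1, 0]` yields `[(p - 2) / p, (p - 1) / p] ⊆ D`.
    refine ⟨(p - 3 / 2) / p, (p - 5 / 4) / p, div_pos (by linarith) (by linarith),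
      div_lt_div_of_pos_right (by linarith) (by linarith),
      by rw [div_lt_one (by linarith)]; linarith, fun y ⟨hy1, hy2⟩ => ?_⟩
    rw [div_le_iff₀ (by linarith)] at hy1
    rw [le_div_iff₀ (by linarith)] at hy2
    have := h.add_div_mem h.isDigit_last (z := y * p - p + 1)
      (hsub ⟨by linarith, by linarith⟩)
    convert this using 1
    push_cast
    field_simp
    ring
  have hacc : ∀ u v, IsGapIoo D u v → IsAccumulated D u := fun u v hg =>
    h.isAccumulated_of_isLeftType (h.exists_notMem h2) hi hg.left_mem
      (h.isLeftType_of_isGapIoo h3 hg)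
  refine ⟨h.perfect, ?_, ?_, ?_⟩
  · obtain ⟨c, hc0, hc1, hc⟩ := h.exists_notMem h2
    obtain ⟨u, v, hg, -⟩ := exists_isGapIoo h.closed h.zero_mem h.one_mem hc hc0 hc1
    exact infinite_isGap_of_isAccumulated h.closed hg hacc
  · intro G hG x hx
    obtain ⟨u, v, hg, rfl⟩ := hG.exists_eq_Ioo h.closed
    rw [hx.unique hg.isGLB]
    exact hacc u v hg
  · intro G hG x hx
    obtain ⟨u, v, hg, rfl⟩ := hG.exists_eq_Ioo h.closed
    rw [hx.unique hg.isLUB]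
    -- By reflection, `D` to the right of `v` is a copy of `D` to the right of `-1`, where it is
    -- full.
    obtain ⟨s, hs, hsD⟩ := h.neg.isLeftType_of_isGapIoo (by omega) hg.neg
    refine isEndpointOfProperComponent_of_Icc_subset hg (w := v + s / 2) (by linarith)
      fun y ⟨hy1, hy2⟩ => ?_
    rcases eq_or_lt_of_le hy1 with rfl | hy1
    · exact hg.right_mem
    have h4 : 0 < (y - v) / s := div_pos (by linarith) hs
    have h5 : (y - v) / s < 1 := by rw [div_lt_one hs]; linarith
    have := (hsD (1 - (y - v) / s) (by linarith) (by linarith)).2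
      (hsub ⟨by linarith, by linarith⟩)
    rw [Set.mem_neg] at this
    convert this using 1
    field_simp
    ring

/-- No two adjacent integers are missing between the blocks, so `⌊p * x⌋` or its successor is a
digit, except at `x = 1`, where `p - 1` serves. -/
theorem eq_Icc (h : IsThreeBlockSet p a b m M D) (h1 : p ≤ a + m) (h2 : p ≤ b + M) :
    D = Set.Icc (-1 : ℝ) 1 := by
  have hp := h.three_le_cast
  have hm := h.one_le_m; have hM := h.one_le_M; have hmb := h.m_lt; have hMa := h.M_lt
  refine Set.Subset.antisymm (fun x hx => ⟨h.neg_one_le hx, h.le_one hx⟩) ?_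
  refine h.subset _ (fun x hx => _root_.abs_le.2 ⟨hx.1, hx.2⟩) fun x hx => ?_
  have hk1 := Int.floor_le ((p : ℝ) * x)
  have hk2 := Int.lt_floor_add_one ((p : ℝ) * x)
  have hx0 : (p : ℝ) * x ≤ p := by nlinarith [hx.2]
  have hx1 : -(p : ℝ) ≤ p * x := by nlinarith [hx.1]
  have hk3 : -(p : ℤ) ≤ ⌊(p : ℝ) * x⌋ := Int.le_floor.2 (by push_cast; exact hx1)
  rcases le_or_gt (p : ℤ) ⌊(p : ℝ) * x⌋ with hle | hlt
  · have : ((p : ℤ) : ℝ) ≤ ⌊(p : ℝ) * x⌋ := by exact_mod_cast hle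
    push_cast at this
    refine ⟨_, h.isDigit_last, ?_, ?_⟩ <;> push_cast <;> linarith
  · generalize ⌊(p : ℝ) * x⌋ = k at *
    by_cases hd : IsDigit p a b m M k
    · exact ⟨k, hd, by linarith, by linarith⟩
    · refine ⟨k + 1, ?_, ?_, ?_⟩
      · unfold IsDigit at *
        omega
      · push_cast; linarith
      · push_cast; linarith

end IsThreeBlockSet

/-! ### Application to S-Cantor sets -/

theorem isThreeBlockSet_C_sub_C {l₁ r₁ l₂ r₂ p : ℕ}
    (hl₁ : 1 ≤ l₁) (hr₁ : 1 ≤ r₁) (hl₂ : 1 ≤ l₂) (hr₂ : 1 ≤ r₂)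
    (hp : 2 < p) (h₁ : l₁ + r₁ < p) (h₂ : l₂ + r₂ < p) :
    IsThreeBlockSet p (l₁ + r₂) (r₁ + l₂) (max l₂ r₁) (max l₁ r₂) (C l₁ r₁ p - C l₂ r₂ p) := by
  have hD : C l₁ r₁ p - C l₂ r₂ p = digitSums (digits l₁ r₁ p - digits l₂ r₂ p) p :=
    digitSums_sub hp.le _ _
  have hmem : ∀ d, d ∈ digits l₁ r₁ p - digits l₂ r₂ p ↔
      IsDigit p (l₁ + r₂) (r₁ + l₂) (max l₂ r₁) (max l₁ r₂) d :=
    mem_digits_sub_digits hl₁ hr₁ hl₂ hr₂ h₁ h₂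
  have hB : ∀ d ∈ digits l₁ r₁ p - digits l₂ r₂ p, |d| ≤ (p : ℤ) - 1 := by
    intro d hd
    rw [hmem] at hd
    unfold IsDigit at hd
    rw [abs_le]
    omega
  rw [hD]
  exact
  { three_le := hp
    one_le_m := by omega
    one_le_M := by omega
    m_lt := by omega
    M_lt := by omega
    b_le := by omega
    a_le := by omega
    m_le := by omega
    M_le := by omega
    closed := isClosed_digitSums hp.le hB
    abs_le := fun x hx => abs_le_one_of_mem_digitSums hp.le hB hx
    mem_iff := fun x => by simp only [mem_digitSums_iff hp.le _ x, hmem]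
    subset := fun S hS hd => subset_digitSums hp.le hS (by simpa only [hmem] using hd) }

end SCantor

theorem theorem5 (l₁ r₁ l₂ r₂ p : ℕ)
    (hl₁ : 1 ≤ l₁) (hr₁ : 1 ≤ r₁) (hl₂ : 1 ≤ l₂) (hr₂ : 1 ≤ r₂)
    (hp : 2 < p) (h₁ : l₁ + r₁ < p) (h₂ : l₂ + r₂ < p) :
    (SCantor.C l₁ r₁ p - SCantor.C l₂ r₂ p = Set.Icc (-1 : ℝ) 1 ↔
      SCantor.S1 l₁ r₁ l₂ r₂ p ∧ SCantor.S2 l₁ r₁ l₂ r₂ p) ∧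
    (SCantor.IsCantorSet (SCantor.C l₁ r₁ p - SCantor.C l₂ r₂ p) ↔
      SCantor.S3 l₁ r₁ l₂ r₂ p) ∧
    (SCantor.IsLCantorval (SCantor.C l₁ r₁ p - SCantor.C l₂ r₂ p) ↔
      SCantor.S1Star l₁ r₁ l₂ r₂ p ∧ ¬ SCantor.S2 l₁ r₁ l₂ r₂ p) ∧
    (SCantor.IsRCantorval (SCantor.C l₁ r₁ p - SCantor.C l₂ r₂ p) ↔
      SCantor.S2Star l₁ r₁ l₂ r₂ p ∧ ¬ SCantor.S1 l₁ r₁ l₂ r₂ p) ∧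
    (SCantor.IsMCantorval (SCantor.C l₁ r₁ p - SCantor.C l₂ r₂ p) ↔
      ¬ SCantor.S1Star l₁ r₁ l₂ r₂ p ∧ ¬ SCantor.S2Star l₁ r₁ l₂ r₂ p ∧
        ¬ SCantor.S3 l₁ r₁ l₂ r₂ p ∧
        (¬ SCantor.S1 l₁ r₁ l₂ r₂ p ∨ ¬ SCantor.S2 l₁ r₁ l₂ r₂ p)) := by
  obtain ⟨a, b, m, M, h, hS1, hS2, hS3, hS1', hS2'⟩ : ∃ a b m M : ℤ,
      SCantor.IsThreeBlockSet p a b m M (SCantor.C l₁ r₁ p - SCantor.C l₂ r₂ p) ∧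
      (SCantor.S1 l₁ r₁ l₂ r₂ p ↔ p ≤ a + m) ∧ (SCantor.S2 l₁ r₁ l₂ r₂ p ↔ p ≤ b + M) ∧
      (SCantor.S3 l₁ r₁ l₂ r₂ p ↔ a + b ≤ p) ∧ (SCantor.S1Star l₁ r₁ l₂ r₂ p ↔ p < a + m) ∧
      (SCantor.S2Star l₁ r₁ l₂ r₂ p ↔ p < b + M) := by
    refine ⟨_, _, _, _, SCantor.isThreeBlockSet_C_sub_C hl₁ hr₁ hl₂ hr₂ hp h₁ h₂, ?_⟩
    unfold SCantor.S1 SCantor.S2 SCantor.S3 SCantor.S1Star SCantor.S2Star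
    omega
  rw [hS1, hS2, hS3, hS1', hS2']
  generalize SCantor.C l₁ r₁ p - SCantor.C l₂ r₂ p = D at h
  have hm := h.m_lt
  have hM := h.M_lt
  have hI : p ≤ a + m ∧ p ≤ b + M → D = Set.Icc (-1 : ℝ) 1 := fun hS => h.eq_Icc hS.1 hS.2
  have hCan : a + b ≤ p → SCantor.IsCantorSet D := h.isCantorSet
  have hL : p < a + m ∧ ¬ p ≤ b + M → SCantor.IsLCantorval D := fun hS =>
    h.isLCantorval hS.1 (not_le.1 hS.2)
  have hR : p < b + M ∧ ¬ p ≤ a + m → SCantor.IsRCantorval D := fun hS => by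
    simpa using (h.neg.isLCantorval hS.1 (not_le.1 hS.2)).neg
  have hMv : ¬ p < a + m ∧ ¬ p < b + M ∧ ¬ a + b ≤ p ∧ (¬ p ≤ a + m ∨ ¬ p ≤ b + M) →
      SCantor.IsMCantorval D := fun hS => h.isMCantorval (by omega) (by omega) (by omega) (by omega)
  have hIC : D = Set.Icc (-1 : ℝ) 1 → ¬ SCantor.IsCantorSet D := by
    rintro rfl hC
    have := hC.nowhereDense
    rw [isClosed_Icc.isNowhereDense_iff, interior_Icc] at this
    exact (Set.nonempty_Ioo.2 (by norm_num)).ne_empty this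
  have hIg : D = Set.Icc (-1 : ℝ) 1 → ¬ {G | SCantor.IsGap D G}.Infinite := by
    rintro rfl
    exact SCantor.finite_isGap_Icc _ _
  have hIL : D = Set.Icc (-1 : ℝ) 1 → ¬ SCantor.IsLCantorval D := fun e h' =>
    hIg e h'.infinite_gaps
  have hIR : D = Set.Icc (-1 : ℝ) 1 → ¬ SCantor.IsRCantorval D := fun e h' =>
    hIg e h'.infinite_gaps
  have hIM : D = Set.Icc (-1 : ℝ) 1 → ¬ SCantor.IsMCantorval D := fun e h' =>
    hIg e h'.infinite_gaps
  have hCL : SCantor.IsCantorSet D → ¬ SCantor.IsLCantorval D := fun h => h.not_isLCantorval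
  have hCR : SCantor.IsCantorSet D → ¬ SCantor.IsRCantorval D := fun h => h.not_isRCantorval
  have hCM : SCantor.IsCantorSet D → ¬ SCantor.IsMCantorval D := fun h => h.not_isMCantorval
  have hLR : SCantor.IsLCantorval D → ¬ SCantor.IsRCantorval D := fun h => h.not_isRCantorval
  have hLM : SCantor.IsLCantorval D → ¬ SCantor.IsMCantorval D := fun h => h.not_isMCantorval
  have hRM : SCantor.IsRCantorval D → ¬ SCantor.IsMCantorval D := fun h => h.not_isMCantorval
  have hcases : (p ≤ a + m ∧ p ≤ b + M) ∨ a + b ≤ p ∨ (p < a + m ∧ ¬ p ≤ b + M) ∨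
      (p < b + M ∧ ¬ p ≤ a + m) ∨
      (¬ p < a + m ∧ ¬ p < b + M ∧ ¬ a + b ≤ p ∧ (¬ p ≤ a + m ∨ ¬ p ≤ b + M)) := by omega
  rcases hcases with hc | hc | hc | hc | hc
  · have hX := hI hc
    exact ⟨iff_of_true hX hc,
      iff_of_false (hIC hX) (by omega),
      iff_of_false (hIL hX) (by omega),
      iff_of_false (hIR hX) (by omega),
      iff_of_false (hIM hX) (by omega)⟩
  · have hX := hCan hc
    exact ⟨iff_of_false (fun hY => hIC hY hX) (by omega),
      iff_of_true hX hc,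
      iff_of_false (hCL hX) (by omega),
      iff_of_false (hCR hX) (by omega),
      iff_of_false (hCM hX) (by omega)⟩
  · have hX := hL hc
    exact ⟨iff_of_false (fun hY => hIL hY hX) (by omega),
      iff_of_false (fun hY => hCL hY hX) (by omega),
      iff_of_true hX hc,
      iff_of_false (hLR hX) (by omega),
      iff_of_false (hLM hX) (by omega)⟩
  · have hX := hR hc
    exact ⟨iff_of_false (fun hY => hIR hY hX) (by omega),
      iff_of_false (fun hY => hCR hY hX) (by omega),
      iff_of_false (fun hY => hLR hY hX) (by omega),
      iff_of_true hX hc,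
      iff_of_false (hRM hX) (by omega)⟩
  · have hX := hMv hc
    exact ⟨iff_of_false (fun hY => hIM hY hX) (by omega),
      iff_of_false (fun hY => hCM hY hX) (by omega),
      iff_of_false (fun hY => hLM hY hX) (by omega),
      iff_of_false (fun hY => hRM hY hX) (by omega),
      iff_of_true hX hc⟩
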